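/- Let $\mathbb F=\mathbb R$ or $\mathbb C$ and let $(\mathbb X,\|\cdot\|)$ be a quasi-Banach space over $\mathbb F$, i.e. a vector space with a quasi-norm ($\|x\|\ge 0$; $\|x\|=0$ iff $x=0$; $\|tx\|=|t|\|x\|$; $\|x+y\|\le\kappa(\|x\|+\|y\|)$ for some constant $\kappa\ge1$) for which it is complete. Let $\mathcal B=(e_n)_{n\ge1}$ be a semi-normalized Markushevich basis (M-basis) of $\mathbb X$: there are functionals $e_n^*\in\mathbb X^*$ with $e_i^*(e_j)=\delta_{ij}$; there are $c_1,c_2>0$ with $c_1\le\|e_n\|,\|e_n^*\|_*\le c_2$ for all $n$, where $\|f\|_*=\sup_{\|x\|\le 1}|f(x)|$; the span of $(e_n)$ is dense in $\mathbb X$; and $e_n^*(x)=0$ for all $n$ implies $x=0$. Throughout, $m,n,k,M$ denote positive integers. A greedy ordering of $x$ is an injective map $\pi:\mathbb N\to\mathbb N$ with $\{n:e_n^*(x)\ne0\}\subset\pi(\mathbb N)$ and $|e^*_{\pi(i)}(x)|\ge|e^*_{\pi(j)}(x)|$ whenever $i\le j$. Put $$\gamma_m(x)=\sup_\pi\Big\|x-\sum_{i=1}^m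 e^*_{\pi(i)}(x)e_{\pi(i)}\Big\|,\qquad \vartheta_m(x)=\sup_\pi\inf_{a_1,\dots,a_m\in\mathbb F}\Big\|x-\sum_{i=1}^m a_ie_{\pi(i)}\Big\|,$$ the suprema being over all greedy orderings $\pi$ of $x$, and $$\sigma_m(x)=\inf\Big\{\Big\|x-\sum_{n\in A}b_ne_n\Big\|:A\subset\mathbb N,\ |A|=m,\ b_n\in\mathbb F\Big\}.$$ The basis $\mathcal B$ is quasi-greedy if there is $C>0$ with $\gamma_m(x)\le C\|x\|$ for all $x,m$; semi-greedy if there is $C>0$ with $\vartheta_m(x)\le C\sigma_m(x)$ for all $x,m$; Schauder if there is $C>0$ with $\|\sum_{n=1}^m e_n^*(x)e_n\|\le C\|x\|$ for all $x,m$. For finite $A\subset\mathbb N$ and scalars $\varepsilon=(\varepsilon_n)_{n\in A}$ of modulus one (written $|\varepsilon|=1$) let $1_{\varepsilon A}=\sum_{n\in A}\varepsilon_ne_n$, and let $h_r(n)=\sup\{\|1_{\varepsilon A}\|:|A|\le n,\ |\varepsilon|=1\}$. The basis has Property (W) if there is $C>0$ such that for all $n$ and all $m\ge n$ there are $A\subset\{m+1,m+2,\dots\}$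 with $|A|=n$ and $|\varepsilon|=1$ such that $h_r(n)\le C\|1_{\varepsilon A}\|$. Let $\omega=(\omega(n))_{n\ge1}$ be a doubling weight: $0<\omega(1)\le\omega(2)\le\cdots$, $\lim_n\omega(n)=\infty$, and $\omega(2n)\le\theta\,\omega(n)$ for all $n$ and some constant $\theta\ge1$. Assume that its lower dilation index $$i_\omega=\sup_{M>1}\frac{\ln\varphi_\omega(M)}{\ln M},\qquad \varphi_\omega(M)=\inf_{k\ge1}\frac{\omega(Mk)}{\omega(k)},$$ is positive. For $0<q<\infty$ let $$\|x\|_{\mathcal A_q^\omega}=\|x\|+\Big[\sum_{n=1}^\infty(\omega(n)\sigma_n(x))^q\frac1n\Big]^{1/q},\qquad \|x\|_{\mathcal A_\infty^\omega}=\|x\|+\sup_{n\ge1}\omega(n)\sigma_n(x),$$ and $\mathcal A_q^\omega=\{x\in\mathbb X:\|x\|_{\mathcal A_q^\omega}<\infty\}$ for $0<q\le\infty$; the class $\mathcal{CG}_q^\omega$ and $\|\cdot\|_{\mathcal{CG}_q^\omega}$ are defined in the same way with $\vartheta_n$ in place of $\sigma_n$. For two such classes, $Y\hookrightarrow Z$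 means that $Y\subset Z$ and there is $C>0$ with $\|x\|_Z\le C\|x\|_Y$ for all $x\in Y$; and $Y\approx Z$ means $Y\hookrightarrow Z$ and $Z\hookrightarrow Y$. **Theorem.** Let $\omega$ be a doubling weight with $i_\omega>0$ and let $\mathcal B$ be a quasi-greedy M-basis of a quasi-Banach space $\mathbb X$. 1. If $\mathcal B$ is semi-greedy, then $\mathcal A_q^\omega\approx\mathcal{CG}_q^\omega$ for all $q\in(0,\infty]$. 2. If $\mathcal B$ is Schauder with Property (W) and $\mathcal A_q^\omega\approx\mathcal{CG}_q^\omega$ for some $q\in(0,\infty]$, then $\mathcal B$ is semi-greedy. -/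

import Mathlib

open scoped ENNReal

noncomputable section

/-- `N` is a quasi-norm on the `𝕜`-vector space `X` for which `X` is complete, i.e. `(X, N)` is a
quasi-Banach space. Completeness is with respect to the (metrizable) vector topology given by the
sets `{x | N x < r}`, so it is stated with sequences. -/
structure IsQuasiBanach (𝕜 : Type*) {X : Type*} [RCLike 𝕜] [AddCommGroup X] [Module 𝕜 X]
    (N : X → ℝ) : Prop where
  nonneg : ∀ x, 0 ≤ N x
  eq_zero_iff : ∀ x, N x = 0 ↔ x = 0
  smul : ∀ (t : 𝕜) (x : X), N (t • x) = ‖t‖ * N x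
  add_le : ∃ κ : ℝ, 1 ≤ κ ∧ ∀ x y, N (x + y) ≤ κ * (N x + N y)
  complete : ∀ u : ℕ → X,
    (∀ ε : ℝ, 0 < ε → ∃ n₀ : ℕ, ∀ m, n₀ ≤ m → ∀ n, n₀ ≤ n → N (u m - u n) < ε) →
    ∃ x : X, Filter.Tendsto (fun n => N (u n - x)) Filter.atTop (nhds 0)

/-- The norm `‖f‖_* = sup {|f x| : N x ≤ 1}` of a linear functional; it is finite exactly when `f`
is continuous. -/
def dualQNorm {𝕜 X : Type*} [RCLike 𝕜] [AddCommGroup X] [Module 𝕜 X]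
    (N : X → ℝ) (f : X →ₗ[𝕜] 𝕜) : ℝ≥0∞ :=
  ⨆ (x : X) (_ : N x ≤ 1), ENNReal.ofReal ‖f x‖

/-- `(e n)` is a semi-normalized Markushevich basis with biorthogonal functionals `(es n)`.
Basis vectors are numbered from `0`: `e n` is the `(n+1)`-st vector of the basis. -/
structure IsMBasis {𝕜 X : Type*} [RCLike 𝕜] [AddCommGroup X] [Module 𝕜 X]
    (N : X → ℝ) (e : ℕ → X) (es : ℕ → X →ₗ[𝕜] 𝕜) : Prop where
  biorthogonal : ∀ i j, es i (e j) = if i = j then 1 else 0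
  seminormalized : ∃ c₁ c₂ : ℝ, 0 < c₁ ∧ ∀ n,
    (c₁ ≤ N (e n) ∧ N (e n) ≤ c₂) ∧
    (ENNReal.ofReal c₁ ≤ dualQNorm N (es n) ∧ dualQNorm N (es n) ≤ ENNReal.ofReal c₂)
  dense_span : ∀ (x : X) (ε : ℝ), 0 < ε →
    ∃ y ∈ Submodule.span 𝕜 (Set.range e), N (x - y) < ε
  total : ∀ x : X, (∀ n, es n x = 0) → x = 0

/-- `S_m x`, the sum of the first `m` terms of the expansion of `x`. -/
def basisPartialSum {𝕜 X : Type*} [RCLike 𝕜] [AddCommGroup X] [Module 𝕜 X]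
    (e : ℕ → X) (es : ℕ → X →ₗ[𝕜] 𝕜) (m : ℕ) (x : X) : X :=
  ∑ n ∈ Finset.range m, es n x • e n

/-- The additional requirement for an M-basis to be a Schauder basis. -/
def IsSchauder {𝕜 X : Type*} [RCLike 𝕜] [AddCommGroup X] [Module 𝕜 X]
    (N : X → ℝ) (e : ℕ → X) (es : ℕ → X →ₗ[𝕜] 𝕜) : Prop :=
  ∃ C : ℝ, 0 < C ∧ ∀ (m : ℕ) (x : X), 1 ≤ m → N (basisPartialSum e es m x) ≤ C * N x

/-- `π` is a greedy ordering of `x`. (It need not be onto: indices outside the support of `x` may be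
left out, as they must be if `x` has infinite support that is not everything.) -/
structure IsGreedyOrdering {𝕜 X : Type*} [RCLike 𝕜] [AddCommGroup X] [Module 𝕜 X]
    (es : ℕ → X →ₗ[𝕜] 𝕜) (x : X) (π : ℕ → ℕ) : Prop where
  injective : Function.Injective π
  support_subset : {n | es n x ≠ 0} ⊆ Set.range π
  decreasing : ∀ i j, i ≤ j → ‖es (π j) x‖ ≤ ‖es (π i) x‖

/-- `G_m^π x`, the greedy sum of `x` of order `m` for the ordering `π`. -/
def greedySum {𝕜 X : Type*} [RCLike 𝕜] [AddCommGroup X] [Module 𝕜 X]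
    (e : ℕ → X) (es : ℕ → X →ₗ[𝕜] 𝕜) (π : ℕ → ℕ) (m : ℕ) (x : X) : X :=
  ∑ i ∈ Finset.range m, es (π i) x • e (π i)

/-- The greedy error `γ_m(x) = sup_π ‖x - G_m^π x‖`. -/
def greedyError {𝕜 X : Type*} [RCLike 𝕜] [AddCommGroup X] [Module 𝕜 X]
    (N : X → ℝ) (e : ℕ → X) (es : ℕ → X →ₗ[𝕜] 𝕜) (m : ℕ) (x : X) : ℝ≥0∞ :=
  ⨆ (π : ℕ → ℕ) (_ : IsGreedyOrdering es x π), ENNReal.ofReal (N (x - greedySum e es π m x))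

/-- The Chebyshev-greedy error
`ϑ_m(x) = sup_π inf_{a_1, …, a_m} ‖x - ∑_{i ≤ m} a_i e_{π(i)}‖`. -/
def chebyshevGreedyError {𝕜 X : Type*} [RCLike 𝕜] [AddCommGroup X] [Module 𝕜 X]
    (N : X → ℝ) (e : ℕ → X) (es : ℕ → X →ₗ[𝕜] 𝕜) (m : ℕ) (x : X) : ℝ≥0∞ :=
  ⨆ (π : ℕ → ℕ) (_ : IsGreedyOrdering es x π),
    ⨅ a : ℕ → 𝕜, ENNReal.ofReal (N (x - ∑ i ∈ Finset.range m, a i • e (π i)))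

/-- The `m`-term error of approximation `σ_m(x)`. -/
def bestTermError (𝕜 : Type*) {X : Type*} [RCLike 𝕜] [AddCommGroup X] [Module 𝕜 X]
    (N : X → ℝ) (e : ℕ → X) (m : ℕ) (x : X) : ℝ≥0∞ :=
  ⨅ (A : Finset ℕ) (_ : A.card = m) (b : ℕ → 𝕜), ENNReal.ofReal (N (x - ∑ n ∈ A, b n • e n))

def IsQuasiGreedy {𝕜 X : Type*} [RCLike 𝕜] [AddCommGroup X] [Module 𝕜 X]
    (N : X → ℝ) (e : ℕ → X) (es : ℕ → X →ₗ[𝕜] 𝕜) : Prop :=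
  ∃ C : ℝ, 0 < C ∧ ∀ (m : ℕ) (x : X), 1 ≤ m →
    greedyError N e es m x ≤ ENNReal.ofReal C * ENNReal.ofReal (N x)

def IsSemiGreedy {𝕜 X : Type*} [RCLike 𝕜] [AddCommGroup X] [Module 𝕜 X]
    (N : X → ℝ) (e : ℕ → X) (es : ℕ → X →ₗ[𝕜] 𝕜) : Prop :=
  ∃ C : ℝ, 0 < C ∧ ∀ (m : ℕ) (x : X), 1 ≤ m →
    chebyshevGreedyError N e es m x ≤ ENNReal.ofReal C * bestTermError 𝕜 N e m x

/-- The indicator sum `1_{εA}`. -/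
def indicatorSum {𝕜 X : Type*} [RCLike 𝕜] [AddCommGroup X] [Module 𝕜 X]
    (e : ℕ → X) (ε : ℕ → 𝕜) (A : Finset ℕ) : X :=
  ∑ n ∈ A, ε n • e n

/-- The upper (right) democracy function
`h_r(m) = sup {‖1_{εA}‖ : |A| ≤ m, |ε| = 1}`. -/
def upperDemocracy (𝕜 : Type*) {X : Type*} [RCLike 𝕜] [AddCommGroup X] [Module 𝕜 X]
    (N : X → ℝ) (e : ℕ → X) (m : ℕ) : ℝ≥0∞ :=
  ⨆ (A : Finset ℕ) (_ : A.card ≤ m) (ε : ℕ → 𝕜) (_ : ∀ n ∈ A, ‖ε n‖ = 1),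
    ENNReal.ofReal (N (indicatorSum e ε A))

/-- Property (W). As `e` is numbered from `0`, "all indices in `A` exceed `m`" reads
`∀ k ∈ A, m < k + 1`. -/
def HasPropertyW (𝕜 : Type*) {X : Type*} [RCLike 𝕜] [AddCommGroup X] [Module 𝕜 X]
    (N : X → ℝ) (e : ℕ → X) : Prop :=
  ∃ C : ℝ, 0 < C ∧ ∀ n m : ℕ, 1 ≤ n → n ≤ m →
    ∃ (A : Finset ℕ) (ε : ℕ → 𝕜), (∀ k ∈ A, m < k + 1) ∧ A.card = n ∧ (∀ k ∈ A, ‖ε k‖ = 1) ∧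
      upperDemocracy 𝕜 N e n ≤ ENNReal.ofReal C * ENNReal.ofReal (N (indicatorSum e ε A))

/-- Doubling weights `ω(1), ω(2), …`: positive, nondecreasing, tending to infinity, and
`ω(2n) ≤ θ ω(n)`. The value `ω 0` plays no role here or below. -/
structure IsDoublingWeight (ω : ℕ → ℝ) : Prop where
  pos : 0 < ω 1
  mono : ∀ m n, 1 ≤ m → m ≤ n → ω m ≤ ω n
  tendsto : Filter.Tendsto ω Filter.atTop Filter.atTop
  doubling : ∃ θ : ℝ, 1 ≤ θ ∧ ∀ n, 1 ≤ n → ω (2 * n) ≤ θ * ω n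

/-- `φ_ω(M) = inf_{k ≥ 1} ω(M k) / ω(k)`. -/
def lowerDilation (ω : ℕ → ℝ) (M : ℕ) : ℝ :=
  ⨅ k : ℕ, ω (M * (k + 1)) / ω (k + 1)

/-- The lower dilation index `i_ω = sup_{M > 1} ln φ_ω(M) / ln M`. -/
def lowerDilationIndex (ω : ℕ → ℝ) : EReal :=
  ⨆ (M : ℕ) (_ : 1 < M), ((Real.log (lowerDilation ω M) / Real.log M : ℝ) : EReal)

/-- `‖x‖ + (∑_{n ≥ 1} (ω(n) E_n(x))^q / n)^{1/q}` for `q < ∞`, and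
`‖x‖ + sup_{n ≥ 1} ω(n) E_n(x)` for `q = ∞`, where `E_n` is a sequence of errors. -/
def errorQNorm {X : Type*} (N : X → ℝ) (ω : ℕ → ℝ) (q : ℝ≥0∞) (E : ℕ → X → ℝ≥0∞) (x : X) :
    ℝ≥0∞ :=
  ENNReal.ofReal (N x) +
    if q = ∞ then ⨆ n : ℕ, ENNReal.ofReal (ω (n + 1)) * E (n + 1) x
    else (∑' n : ℕ, (ENNReal.ofReal (ω (n + 1)) * E (n + 1) x) ^ q.toReal
      / ((n + 1 : ℕ) : ℝ≥0∞)) ^ (1 / q.toReal)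

/-- The quasi-norm of the approximation space `𝒜_q^ω`, with value `∞` outside the space. -/
def approxQNorm (𝕜 : Type*) {X : Type*} [RCLike 𝕜] [AddCommGroup X] [Module 𝕜 X]
    (N : X → ℝ) (e : ℕ → X) (ω : ℕ → ℝ) (q : ℝ≥0∞) : X → ℝ≥0∞ :=
  errorQNorm N ω q (bestTermError 𝕜 N e)

/-- The quantity `‖·‖` of the Chebyshev-greedy class `𝒞𝒢_q^ω`, with value `∞` outside it. -/
def chebyshevQNorm {𝕜 X : Type*} [RCLike 𝕜] [AddCommGroup X] [Module 𝕜 X]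
    (N : X → ℝ) (e : ℕ → X) (es : ℕ → X →ₗ[𝕜] 𝕜) (ω : ℕ → ℝ) (q : ℝ≥0∞) : X → ℝ≥0∞ :=
  errorQNorm N ω q (chebyshevGreedyError N e es)

/-- The class of the `x` at which a quantity is finite. -/
def finiteClass {X : Type*} (ν : X → ℝ≥0∞) : Set X := {x | ν x < ∞}

/-- `Y ↪ Z` for the classes `Y`, `Z` given by `ν`, `μ`: `Y ⊆ Z` and `‖x‖_Z ≤ C ‖x‖_Y` on `Y`. -/
def ContEmbeds {X : Type*} (ν μ : X → ℝ≥0∞) : Prop :=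
  finiteClass ν ⊆ finiteClass μ ∧
    ∃ C : ℝ, 0 < C ∧ ∀ x ∈ finiteClass ν, μ x ≤ ENNReal.ofReal C * ν x

/-- `Y ≈ Z`: embeddings in both directions. -/
def ClassesEquiv {X : Type*} (ν μ : X → ℝ≥0∞) : Prop :=
  ContEmbeds ν μ ∧ ContEmbeds μ ν

end

/-! ### Quasi-norm estimates -/

section QuasiNorm

variable {𝕜 : Type*} [RCLike 𝕜] {X : Type*} [AddCommGroup X] [Module 𝕜 X] {N : X → ℝ}

/-! Since a Chebyshev-greedy sum of order `m` is an `m`-term approximant, `σ_m ≤ ϑ_m` always.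
Semi-greediness is the reverse inequality up to a constant, so part 1 compares the two errors term
by term.

Part 2 goes through super-democracy: `h_r(|B|)` is bounded by a multiple of `‖1_{εB}‖`. Let `|B| =
n` and `d ≤ n`. Property (W) gives `D` to the right of `B` with `|D| = d` and `‖1_{δD}‖` of order
`h_r(d)`. For `x = 2·1_{εB} + 1_{δD}` the first `n` greedy choices exhaust `B`, so for `k ≤ n` a
Schauder tail projection recovers `1_{δD}` from any Chebyshev residual and `ϑ_k(x)` is at least of
order `h_r(d)`. On the other hand `σ_k(x) ≤ ‖x‖` always, `σ_k(x) ≤ 2‖1_{εB}‖` for `k ≥ d`, and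
`σ_k(x) = 0` for `k ≥ n + d`. The embedding of `𝒜` into `𝒞𝒢` then bounds `h_r(d) ω(n)` by a multiple
of `(‖1_{εB}‖ + h_r(d)) ω(d) + ‖1_{εB}‖ ω(n)` (`exists_democracy_bound`). As `i_ω > 0`, taking `d`
about `n/M` with `M` large makes `ω(d)` small against `ω(n)`; the term `h_r(d) ω(d)` is absorbed,
and `h_r(n)` is of order `h_r(d)`.

It remains that quasi-greedy and super-democratic imply semi-greedy (`exists_chebyshev_bound`). This
is a truncation argument resting on two estimates: coefficients of modulus at most `t` on `B` cost
at most a multiple of `t h_r(|B|)`, and `s h_r(|{n : |e_n^*(x)| ≥ s}|)` is at most a multiple of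
`‖x‖`. Without convexity both are obtained by iterations in which a geometric factor beats `κ`. -/

theorem IsQuasiBanach.map_zero (hN : IsQuasiBanach 𝕜 N) : N 0 = 0 := (hN.eq_zero_iff 0).2 rfl

theorem IsQuasiBanach.map_neg (hN : IsQuasiBanach 𝕜 N) (x : X) : N (-x) = N x := by
  have := hN.smul (-1 : 𝕜) x
  simpa using this

theorem IsQuasiBanach.exists_modulus (hN : IsQuasiBanach 𝕜 N) :
    ∃ κ : ℝ, 1 ≤ κ ∧ (∀ x y, N (x + y) ≤ κ * (N x + N y)) ∧
      (∀ x y, N (x - y) ≤ κ * (N x + N y)) := by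
  obtain ⟨κ, h1, h2⟩ := hN.add_le
  refine ⟨κ, h1, h2, fun x y => ?_⟩
  have := h2 x (-y)
  rwa [hN.map_neg, ← sub_eq_add_neg] at this

/-- The exponential constant is harmless: the bound serves only to show finiteness and to start an
iteration that shrinks it to zero. -/
theorem IsQuasiBanach.sum_le (hN : IsQuasiBanach 𝕜 N) {κ : ℝ} (hκ : 1 ≤ κ)
    (hadd : ∀ x y, N (x + y) ≤ κ * (N x + N y)) {ι : Type*} (s : Finset ι) (f : ι → X) :
    N (∑ i ∈ s, f i) ≤ κ ^ s.card * ∑ i ∈ s, N (f i) := by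
  classical
  induction s using Finset.induction_on with
  | empty => simp [hN.map_zero]
  | insert a s ha ih =>
    rw [Finset.sum_insert ha, Finset.sum_insert ha, Finset.card_insert_of_notMem ha]
    have h1 : (1 : ℝ) ≤ κ ^ s.card := one_le_pow₀ hκ
    have h2 := hadd (f a) (∑ i ∈ s, f i)
    have h3 := hN.nonneg (f a)
    calc _ ≤ κ * (N (f a) + N (∑ i ∈ s, f i)) := h2
      _ ≤ κ * (κ ^ s.card * N (f a) + κ ^ s.card * ∑ i ∈ s, N (f i)) := by
        gcongr
        exact le_mul_of_one_le_left h3 h1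
      _ = _ := by ring

end QuasiNorm

/-! ### Greedy orderings and greedy projections -/

section Basis

variable {𝕜 : Type*} [RCLike 𝕜] {X : Type*} [AddCommGroup X] [Module 𝕜 X] {N : X → ℝ}
  {e : ℕ → X} {es : ℕ → X →ₗ[𝕜] 𝕜}

theorem IsMBasis.exists_bound (hN : IsQuasiBanach 𝕜 N) (hB : IsMBasis N e es) :
    ∃ c : ℝ, 0 < c ∧ (∀ n, N (e n) ≤ c) ∧ ∀ n x, ‖es n x‖ ≤ c * N x := by
  obtain ⟨c₁, c₂, hc₁, h⟩ := hB.seminormalized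
  have hc : 0 < c₂ := lt_of_lt_of_le hc₁ ((h 0).1.1.trans (h 0).1.2)
  refine ⟨c₂, hc, fun n => (h n).1.2, fun n x => ?_⟩
  rcases (hN.nonneg x).eq_or_lt with h0 | h0
  · rw [(hN.eq_zero_iff x).1 h0.symm]; simp [hN.map_zero]
  · have h1 : N (((N x)⁻¹ : 𝕜) • x) ≤ 1 := by
      rw [hN.smul]; simp [abs_of_pos h0, h0.ne']
    have h2 : ENNReal.ofReal ‖es n (((N x)⁻¹ : 𝕜) • x)‖ ≤ ENNReal.ofReal c₂ :=
      le_trans (le_iSup₂ (f := fun (x : X) (_ : N x ≤ 1) => ENNReal.ofReal ‖es n x‖) _ h1)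
        (h n).2.2
    rw [ENNReal.ofReal_le_ofReal_iff hc.le, map_smul, norm_smul] at h2
    simp only [norm_inv, RCLike.norm_ofReal, abs_of_pos h0] at h2
    rwa [inv_mul_le_iff₀ h0, mul_comm] at h2

theorem IsMBasis.coeff_sum (hB : IsMBasis N e es) (A : Finset ℕ) (a : ℕ → 𝕜) (n : ℕ) :
    es n (∑ k ∈ A, a k • e k) = if n ∈ A then a n else 0 := by
  simp [hB.biorthogonal]

/-- Some `y` in the span of the basis is so close to `x` that no coefficient differs by `s`; hence
every large coefficient of `x` lies in the finite support of `y`. -/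
theorem IsMBasis.finite_level (hN : IsQuasiBanach 𝕜 N) (hB : IsMBasis N e es) (x : X) {s : ℝ}
    (hs : 0 < s) : {n | s ≤ ‖es n x‖}.Finite := by
  obtain ⟨c, hc, -, hes⟩ := hB.exists_bound hN
  obtain ⟨y, hy, hxy⟩ := hB.dense_span x (s / c) (by positivity)
  have hfin : {n | es n y ≠ 0}.Finite := by
    clear hxy
    induction hy using Submodule.span_induction with
    | mem y hy =>
      obtain ⟨i, rfl⟩ := hy
      refine (Set.finite_singleton i).subset fun n hn => ?_
      by_contra h
      exact hn (by simp [hB.biorthogonal, show n ≠ i from h])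
    | zero => simp
    | add y z _ _ ihy ihz =>
      refine (ihy.union ihz).subset fun n hn => ?_
      by_contra h
      simp only [Set.mem_union, Set.mem_ofPred_eq, not_or, not_not] at h
      exact hn (by simp [h.1, h.2])
    | smul a y _ ih =>
      refine ih.subset fun n hn h => hn (by simp [h])
  refine hfin.subset fun n hn h => ?_
  have h1 := hes n (x - y)
  rw [map_sub, h, sub_zero] at h1
  have h2 : c * N (x - y) < s := by rwa [lt_div_iff₀ hc, mul_comm] at hxy
  exact absurd (hn.trans h1) (not_le.2 h2)

theorem IsMBasis.exists_max_coeff (hN : IsQuasiBanach 𝕜 N) (hB : IsMBasis N e es) (x : X)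
    (F : Finset ℕ) : ∃ n ∉ F, ∀ k ∉ F, ‖es k x‖ ≤ ‖es n x‖ := by
  by_cases h : ∃ n ∉ F, es n x ≠ 0
  · obtain ⟨n, hn, hx⟩ := h
    have hfin := (hB.finite_level hN x (norm_pos_iff.2 hx)).subset
      (Set.sdiff_subset (t := (F : Set ℕ)))
    obtain ⟨k, hk, hmax⟩ := Set.exists_max_image _ (fun k => ‖es k x‖) hfin
      ⟨n, by simpa using hn⟩
    refine ⟨k, hk.2, fun j hj => ?_⟩
    by_cases hj' : ‖es n x‖ ≤ ‖es j x‖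
    · exact hmax j ⟨hj', hj⟩
    · exact (not_le.1 hj').le.trans hk.1
  · push Not at h
    obtain ⟨n, hn⟩ := Infinite.exists_notMem_finset F
    exact ⟨n, hn, fun k hk => by simp [h k hk]⟩

theorem IsMBasis.exists_greedyOrdering (hN : IsQuasiBanach 𝕜 N) (hB : IsMBasis N e es) (x : X) :
    ∃ π, IsGreedyOrdering es x π := by
  choose g hg hmax using hB.exists_max_coeff hN x
  let F : ℕ → Finset ℕ := fun i => Nat.rec ∅ (fun _ F => insert (g F) F) i
  have hF : ∀ i, F (i + 1) = insert (g (F i)) (F i) := fun i => rfl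
  have hmono : Monotone F := monotone_nat_of_le_succ fun i => by
    rw [hF]; exact Finset.subset_insert _ _
  have hmem : ∀ i j, i < j → g (F i) ∈ F j := fun i j hij =>
    hmono (Nat.succ_le_of_lt hij) (by rw [Nat.succ_eq_add_one, hF]; exact Finset.mem_insert_self _ _)
  have hinj : Function.Injective fun i => g (F i) := by
    intro i j hij
    by_contra hne
    rcases lt_or_gt_of_ne hne with h | h
    · exact hg (F j) (by have := hmem i j h; rwa [show g (F i) = g (F j) from hij] at this)
    · exact hg (F i) (by have := hmem j i h; rwa [show g (F j) = g (F i) from hij.symm] at this)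
  refine ⟨fun i => g (F i), hinj, fun n hn => ?_, fun i j hij => ?_⟩
  -- A support index never chosen would be dominated by all the infinitely many chosen ones, against
  -- `finite_level`.
  · by_contra hr
    have hnF : ∀ i, n ∉ F i := by
      intro i
      induction i with
      | zero => simp [F]
      | succ i ih =>
        rw [hF, Finset.mem_insert, not_or]
        exact ⟨fun h => hr ⟨i, h.symm⟩, ih⟩
    have hfin := hB.finite_level hN x (norm_pos_iff.2 hn)
    exact Set.infinite_range_of_injective hinj
      (hfin.subset (by rintro _ ⟨i, rfl⟩; exact hmax (F i) n (hnF i)))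
  · exact hmax (F i) _ fun h => hg (F j) (hmono hij h)

/-- If the coefficients of `x` on `G` are strictly larger than those off `G`, every greedy
ordering of `x` starts by exhausting `G`. -/
theorem IsGreedyOrdering.image_range {x : X} {π : ℕ → ℕ} (hπ : IsGreedyOrdering es x π)
    {G : Finset ℕ} (hG : ∀ i ∈ G, ∀ j ∉ G, ‖es j x‖ < ‖es i x‖) :
    (Finset.range G.card).image π = G := by
  have hmem : ∀ i < G.card, π i ∈ G := by
    intro i hi
    by_contra h
    have hsub : G ⊆ (Finset.range i).image π := by
      intro n hn
      obtain ⟨k, hk⟩ := Infinite.exists_notMem_finset G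
      have hn0 : es n x ≠ 0 := norm_pos_iff.1 ((norm_nonneg _).trans_lt (hG n hn k hk))
      obtain ⟨j, rfl⟩ := hπ.support_subset hn0
      refine Finset.mem_image_of_mem _ (Finset.mem_range.2 (lt_of_not_ge fun hij => ?_))
      exact absurd (hπ.decreasing i j hij) (not_le.2 (hG _ hn _ h))
    have := (Finset.card_le_card hsub).trans Finset.card_image_le
    rw [Finset.card_range] at this
    omega
  refine Finset.eq_of_subset_of_card_le ?_ ?_
  · intro n hn
    obtain ⟨i, hi, rfl⟩ := Finset.mem_image.1 hn
    exact hmem i (Finset.mem_range.1 hi)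
  · rw [Finset.card_image_of_injective _ hπ.injective, Finset.card_range]

theorem IsGreedyOrdering.sum_range {x : X} {π : ℕ → ℕ} (hπ : IsGreedyOrdering es x π) (m : ℕ)
    (a : ℕ → X) :
    ∑ n ∈ (Finset.range m).image π, a n = ∑ i ∈ Finset.range m, a (π i) :=
  Finset.sum_image fun _ _ _ _ h => hπ.injective h

theorem bestTermError_le_of_sum (x : X) {m : ℕ} {A : Finset ℕ} (hA : A.card = m) (b : ℕ → 𝕜) :
    bestTermError 𝕜 N e m x ≤ ENNReal.ofReal (N (x - ∑ n ∈ A, b n • e n)) :=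
  iInf_le_of_le A (iInf_le_of_le hA (iInf_le _ b))

theorem IsMBasis.bestTermError_le_chebyshevGreedyError (hN : IsQuasiBanach 𝕜 N)
    (hB : IsMBasis N e es) (m : ℕ) (x : X) :
    bestTermError 𝕜 N e m x ≤ chebyshevGreedyError N e es m x := by
  obtain ⟨π, hπ⟩ := hB.exists_greedyOrdering hN x
  refine le_iSup₂_of_le π hπ (le_iInf fun a => ?_)
  have := bestTermError_le_of_sum (𝕜 := 𝕜) (N := N) (e := e) x
    (A := (Finset.range m).image π) (m := m)
    (by rw [Finset.card_image_of_injective _ hπ.injective, Finset.card_range])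
    -- The coefficients `a` are indexed by rank; extension along the injective `π` reindexes them by
    -- basis position.
    (Function.extend π a 0)
  rw [hπ.sum_range m (fun n => Function.extend π a 0 n • e n)] at this
  simpa [hπ.injective.extend_apply] using this

/-- A quasi-greedy basis has uniformly bounded projections onto strictly greedy sets. -/
theorem IsQuasiGreedy.exists_sub_sum_le (hN : IsQuasiBanach 𝕜 N) (hB : IsMBasis N e es)
    (hqg : IsQuasiGreedy N e es) :
    ∃ C : ℝ, 1 ≤ C ∧ ∀ (x : X) (G : Finset ℕ), (∀ i ∈ G, ∀ j ∉ G, ‖es j x‖ < ‖es i x‖) →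
      N (x - ∑ n ∈ G, es n x • e n) ≤ C * N x := by
  obtain ⟨C, hC, h⟩ := hqg
  -- Quasi-greediness concerns orders `m ≥ 1`; the bound `1` covers empty `G`.
  refine ⟨max C 1, le_max_right _ _, fun x G hG => ?_⟩
  rcases G.eq_empty_or_nonempty with rfl | hne
  · simpa using le_mul_of_one_le_left (hN.nonneg x) (le_max_right C 1)
  · obtain ⟨π, hπ⟩ := hB.exists_greedyOrdering hN x
    have h1 := (le_iSup₂ (f := fun (π : ℕ → ℕ) (_ : IsGreedyOrdering es x π) =>
      ENNReal.ofReal (N (x - greedySum e es π G.card x))) π hπ).trans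
        (h G.card x hne.card_pos)
    rw [← ENNReal.ofReal_mul hC.le,
      ENNReal.ofReal_le_ofReal_iff (mul_nonneg hC.le (hN.nonneg x)), greedySum,
      ← hπ.sum_range G.card (fun n => es n x • e n), hπ.image_range hG] at h1
    exact h1.trans (mul_le_mul_of_nonneg_right (le_max_left _ _) (hN.nonneg x))

theorem IsQuasiGreedy.exists_sum_le (hN : IsQuasiBanach 𝕜 N) (hB : IsMBasis N e es)
    (hqg : IsQuasiGreedy N e es) :
    ∃ C : ℝ, 1 ≤ C ∧ ∀ (x : X) (G : Finset ℕ), (∀ i ∈ G, ∀ j ∉ G, ‖es j x‖ < ‖es i x‖) →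
      N (∑ n ∈ G, es n x • e n) ≤ C * N x := by
  obtain ⟨C, hC, h⟩ := hqg.exists_sub_sum_le hN hB
  obtain ⟨κ, hκ, -, hsub⟩ := hN.exists_modulus
  refine ⟨κ * (1 + C), by nlinarith, fun x G hG => ?_⟩
  have h1 := hsub x (x - ∑ n ∈ G, es n x • e n)
  rw [sub_sub_cancel] at h1
  calc _ ≤ _ := h1
    _ ≤ κ * (N x + C * N x) := by gcongr; exact h x G hG
    _ = _ := by ring

end Basis

/-! ### The upper democracy function and bounded coefficients -/

section Democracy

variable {𝕜 : Type*} [RCLike 𝕜] {X : Type*} [AddCommGroup X] [Module 𝕜 X] {N : X → ℝ}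
  {e : ℕ → X} {es : ℕ → X →ₗ[𝕜] 𝕜}

/-- The upper democracy function as a real number. -/
noncomputable def realDemocracy (𝕜 : Type*) {X : Type*} [RCLike 𝕜] [AddCommGroup X] [Module 𝕜 X]
    (N : X → ℝ) (e : ℕ → X) (m : ℕ) : ℝ :=
  (upperDemocracy 𝕜 N e m).toReal

theorem realDemocracy_nonneg (n : ℕ) : 0 ≤ realDemocracy 𝕜 N e n := ENNReal.toReal_nonneg

theorem upperDemocracy_le {n : ℕ} {c : ℝ}
    (h : ∀ (A : Finset ℕ) (ε : ℕ → 𝕜), A.card ≤ n → (∀ k ∈ A, ‖ε k‖ = 1) →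
      N (indicatorSum e ε A) ≤ c) : upperDemocracy 𝕜 N e n ≤ ENNReal.ofReal c :=
  iSup₂_le fun A hA => iSup₂_le fun ε hε => ENNReal.ofReal_le_ofReal (h A ε hA hε)

theorem realDemocracy_le {n : ℕ} {c : ℝ} (hc : 0 ≤ c)
    (h : ∀ (A : Finset ℕ) (ε : ℕ → 𝕜), A.card ≤ n → (∀ k ∈ A, ‖ε k‖ = 1) →
      N (indicatorSum e ε A) ≤ c) : realDemocracy 𝕜 N e n ≤ c :=
  ENNReal.toReal_le_of_le_ofReal hc (upperDemocracy_le h)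

theorem IsMBasis.upperDemocracy_ne_top (hN : IsQuasiBanach 𝕜 N) (hB : IsMBasis N e es) (n : ℕ) :
    upperDemocracy 𝕜 N e n ≠ ∞ := by
  obtain ⟨κ, hκ, hadd, -⟩ := hN.exists_modulus
  obtain ⟨c, hc, hec, -⟩ := hB.exists_bound hN
  refine ne_top_of_le_ne_top (ENNReal.ofReal_ne_top (r := κ ^ n * (n * c)))
    (upperDemocracy_le fun A ε hA hε => ?_)
  calc N (indicatorSum e ε A) ≤ κ ^ A.card * ∑ i ∈ A, N (ε i • e i) := hN.sum_le hκ hadd _ _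
    _ ≤ κ ^ A.card * ∑ i ∈ A, c := by
      gcongr with i hi
      rw [hN.smul, hε i hi, one_mul]; exact hec i
    _ ≤ κ ^ n * (n * c) := by
      rw [Finset.sum_const, nsmul_eq_mul]
      gcongr

theorem IsMBasis.ofReal_realDemocracy (hN : IsQuasiBanach 𝕜 N) (hB : IsMBasis N e es) (n : ℕ) :
    ENNReal.ofReal (realDemocracy 𝕜 N e n) = upperDemocracy 𝕜 N e n :=
  ENNReal.ofReal_toReal (hB.upperDemocracy_ne_top hN n)

theorem IsMBasis.indicatorSum_le (hN : IsQuasiBanach 𝕜 N) (hB : IsMBasis N e es) {n : ℕ}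
    {A : Finset ℕ} {ε : ℕ → 𝕜} (hA : A.card ≤ n) (hε : ∀ k ∈ A, ‖ε k‖ = 1) :
    N (indicatorSum e ε A) ≤ realDemocracy 𝕜 N e n := by
  refine (ENNReal.ofReal_le_iff_le_toReal (hB.upperDemocracy_ne_top hN n)).1 ?_
  exact le_iSup₂_of_le (f := fun (A : Finset ℕ) (_ : A.card ≤ n) =>
    ⨆ (ε : ℕ → 𝕜) (_ : ∀ n ∈ A, ‖ε n‖ = 1), ENNReal.ofReal (N (indicatorSum e ε A))) A hA
    (le_iSup₂ (f := fun (ε : ℕ → 𝕜) (_ : ∀ n ∈ A, ‖ε n‖ = 1) =>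
      ENNReal.ofReal (N (indicatorSum e ε A))) ε hε)

theorem IsMBasis.realDemocracy_mono (hN : IsQuasiBanach 𝕜 N) (hB : IsMBasis N e es) {m n : ℕ}
    (h : m ≤ n) : realDemocracy 𝕜 N e m ≤ realDemocracy 𝕜 N e n :=
  realDemocracy_le (realDemocracy_nonneg n) fun _ _ hA hε => hB.indicatorSum_le hN (hA.trans h) hε

theorem realDemocracy_zero (hN : IsQuasiBanach 𝕜 N) : realDemocracy 𝕜 N e 0 = 0 := by
  refine le_antisymm (realDemocracy_le le_rfl fun A ε hA _ => ?_) (realDemocracy_nonneg 0)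
  rw [Finset.card_eq_zero.1 (Nat.le_zero.1 hA)]
  simp [indicatorSum, hN.map_zero]

theorem IsMBasis.realDemocracy_add_le (hN : IsQuasiBanach 𝕜 N) (hB : IsMBasis N e es) {κ : ℝ}
    (hκ : 1 ≤ κ) (hadd : ∀ x y, N (x + y) ≤ κ * (N x + N y)) (m n : ℕ) :
    realDemocracy 𝕜 N e (m + n) ≤ κ * (realDemocracy 𝕜 N e m + realDemocracy 𝕜 N e n) := by
  have hm := realDemocracy_nonneg (𝕜 := 𝕜) (N := N) (e := e) m
  have hn := realDemocracy_nonneg (𝕜 := 𝕜) (N := N) (e := e) n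
  refine realDemocracy_le (by positivity) fun A ε hA hε => ?_
  rcases le_total A.card m with h | h
  · have := hB.indicatorSum_le hN h hε
    nlinarith
  · obtain ⟨A₁, hA₁, hc⟩ := Finset.exists_subset_card_eq h
    have h1 : indicatorSum e ε A = indicatorSum e ε A₁ + indicatorSum e ε (A \ A₁) := by
      rw [indicatorSum, ← Finset.sum_sdiff hA₁, add_comm]; rfl
    have h2 : (A \ A₁).card ≤ n := by
      rw [Finset.card_sdiff_of_subset hA₁]; omega
    rw [h1]
    refine (hadd _ _).trans ?_
    gcongr
    · exact hB.indicatorSum_le hN hc.le fun k hk => hε k (hA₁ hk)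
    · exact hB.indicatorSum_le hN h2 fun k hk => hε k (Finset.sdiff_subset hk)

theorem IsMBasis.exists_realDemocracy_mul_le (hN : IsQuasiBanach 𝕜 N) (hB : IsMBasis N e es)
    (k : ℕ) : ∃ C : ℝ, 0 ≤ C ∧ ∀ n, realDemocracy 𝕜 N e (k * n) ≤ C * realDemocracy 𝕜 N e n := by
  obtain ⟨κ, hκ, hadd, -⟩ := hN.exists_modulus
  induction k with
  | zero => exact ⟨0, le_rfl, fun n => by simp [realDemocracy_zero hN]⟩
  | succ k ih =>
    obtain ⟨C, hC, h⟩ := ih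
    refine ⟨κ * (C + 1), by positivity, fun n => ?_⟩
    rw [Nat.succ_mul]
    refine (hB.realDemocracy_add_le hN hκ hadd _ _).trans ?_
    have := h n
    have hk : 0 ≤ κ := by linarith
    nlinarith [mul_le_mul_of_nonneg_left this hk]

/-- If `|b_n| ≤ 2c` on `B`, subtracting `c` times the sign of `b_n` wherever `|b_n| > c` leaves
coefficients of modulus at most `c`. Each halving thus costs one indicator sum. -/
theorem IsMBasis.exists_halving (hN : IsQuasiBanach 𝕜 N) (hB : IsMBasis N e es) (j : ℕ) :
    ∃ K : ℝ, 0 ≤ K ∧ ∀ (B : Finset ℕ) (a : ℕ → 𝕜), (∀ n ∈ B, ‖a n‖ ≤ 1) →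
      ∃ b : ℕ → 𝕜, (∀ n ∈ B, ‖b n‖ ≤ (1 / 2 : ℝ) ^ j) ∧
        N (∑ n ∈ B, (a n - b n) • e n) ≤ K * realDemocracy 𝕜 N e B.card := by
  obtain ⟨κ, hκ, hadd, -⟩ := hN.exists_modulus
  induction j with
  | zero => exact ⟨0, le_rfl, fun B a ha => ⟨a, by simpa using ha, by simp [hN.map_zero]⟩⟩
  | succ j ih =>
    obtain ⟨K, hK, h⟩ := ih
    refine ⟨κ * (K + 1), by positivity, fun B a ha => ?_⟩
    obtain ⟨b, hb, hab⟩ := h B a ha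
    set c : ℝ := (1 / 2 : ℝ) ^ (j + 1) with hc
    have hc0 : 0 < c := by positivity
    have hc1 : c ≤ 1 := pow_le_one₀ (by norm_num) (by norm_num)
    have hcj : (1 / 2 : ℝ) ^ j = 2 * c := by rw [hc, pow_succ]; ring
    let B' := B.filter fun n => c < ‖b n‖
    let ε : ℕ → 𝕜 := fun n => ((‖b n‖⁻¹ : ℝ) : 𝕜) * b n
    have hε : ∀ n ∈ B', ‖ε n‖ = 1 := by
      intro n hn
      have h0 : 0 < ‖b n‖ := hc0.trans (Finset.mem_filter.1 hn).2
      simp [ε, h0.ne']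
    refine ⟨fun n => if c < ‖b n‖ then b n - (c : 𝕜) * ε n else b n, fun n hn => ?_, ?_⟩
    · dsimp only
      split_ifs with hcn
      · have h0 : 0 < ‖b n‖ := hc0.trans hcn
        have h1 : b n - (c : 𝕜) * ε n = ((1 - c * ‖b n‖⁻¹ : ℝ) : 𝕜) * b n := by
          simp only [ε]; push_cast; ring
        have h2 : (1 - c * ‖b n‖⁻¹) * ‖b n‖ = ‖b n‖ - c := by field_simp
        have h3 : 0 ≤ 1 - c * ‖b n‖⁻¹ := by
          rw [sub_nonneg, mul_inv_le_iff₀ h0]; linarith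
        rw [h1, norm_mul, RCLike.norm_ofReal, abs_of_nonneg h3, h2]
        have := hb n hn
        linarith
      · exact not_lt.1 hcn
    · have h1 : ∑ n ∈ B, (a n - if c < ‖b n‖ then b n - (c : 𝕜) * ε n else b n) • e n
          = ∑ n ∈ B, (a n - b n) • e n + (c : 𝕜) • indicatorSum e ε B' := by
        rw [indicatorSum, Finset.sum_filter, Finset.smul_sum, ← Finset.sum_add_distrib]
        refine Finset.sum_congr rfl fun n _ => ?_
        split_ifs
        · rw [smul_smul, ← add_smul]; congr 1; ring
        · simp
      rw [h1]
      refine (hadd _ _).trans ?_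
      rw [mul_assoc, hN.smul, RCLike.norm_ofReal, abs_of_pos hc0, add_mul, one_mul]
      gcongr
      have h2 := hB.indicatorSum_le hN (Finset.card_filter_le B _) hε
      have h3 := hN.nonneg (indicatorSum e ε B')
      nlinarith

/-- Coefficients bounded by `t` cost at most a constant times `t` times the upper democracy
function. -/
theorem IsMBasis.exists_sum_le_realDemocracy (hN : IsQuasiBanach 𝕜 N) (hB : IsMBasis N e es) :
    ∃ K : ℝ, 0 < K ∧ ∀ (B : Finset ℕ) (a : ℕ → 𝕜) (t : ℝ), 0 < t → (∀ n ∈ B, ‖a n‖ ≤ t) →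
      N (∑ n ∈ B, a n • e n) ≤ K * t * realDemocracy 𝕜 N e B.card := by
  obtain ⟨κ, hκ, hadd, -⟩ := hN.exists_modulus
  have hκ0 : 0 < κ := by linarith
  -- After `j` halvings the remainder is so small that it contracts by `1/2` even after paying `κ`.
  obtain ⟨j, hj⟩ := exists_pow_lt_of_lt_one (show (0 : ℝ) < 1 / (2 * κ) by positivity)
    (show (1 / 2 : ℝ) < 1 by norm_num)
  obtain ⟨K, hK, h⟩ := hB.exists_halving hN j
  obtain ⟨c, hc, hec, -⟩ := hB.exists_bound hN
  have hr : κ * (1 / 2 : ℝ) ^ j ≤ 1 / 2 := by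
    rw [lt_div_iff₀ (by positivity)] at hj; linarith
  have hr0 : 0 < (1 / 2 : ℝ) ^ j := by positivity
  have hunit : ∀ (B : Finset ℕ) (a : ℕ → 𝕜), (∀ n ∈ B, ‖a n‖ ≤ 1) →
      N (∑ n ∈ B, a n • e n) ≤ 2 * κ * K * realDemocracy 𝕜 N e B.card := by
    intro B
    have hd := realDemocracy_nonneg (𝕜 := 𝕜) (N := N) (e := e) B.card
    -- The remainder, rescaled by `2^j`, is again bounded by `1`, so each pass halves the crude
    -- bound depending on `B`. That bound disappears as `i → ∞` with `B` fixed.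
    have hiter : ∀ i : ℕ, ∀ a : ℕ → 𝕜, (∀ n ∈ B, ‖a n‖ ≤ 1) → N (∑ n ∈ B, a n • e n) ≤
        2 * κ * K * realDemocracy 𝕜 N e B.card + (1 / 2) ^ i * (κ ^ B.card * (B.card * c)) := by
      intro i
      induction i with
      | zero =>
        intro a ha
        have h1 : N (∑ n ∈ B, a n • e n) ≤ κ ^ B.card * (B.card * c) := by
          refine (hN.sum_le hκ hadd _ _).trans ?_
          rw [← nsmul_eq_mul, ← Finset.sum_const]
          gcongr with i hi
          rw [hN.smul]
          have := ha i hi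
          have := hec i
          have := hN.nonneg (e i)
          have := norm_nonneg (a i)
          nlinarith
        have : 0 ≤ 2 * κ * K * realDemocracy 𝕜 N e B.card := by positivity
        simpa using h1.trans (by linarith)
      | succ i ih =>
        intro a ha
        obtain ⟨b, hb, hab⟩ := h B a ha
        have h1 := ih (fun n => (((1 / 2 : ℝ) ^ j)⁻¹ : ℝ) • b n) (fun n hn => by
          rw [norm_smul, Real.norm_of_nonneg (by positivity), inv_mul_le_iff₀ hr0, mul_one]
          exact hb n hn)
        have h2 : ∑ n ∈ B, a n • e n = ∑ n ∈ B, (a n - b n) • e n +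
            (((1 / 2 : ℝ) ^ j : ℝ) : 𝕜) • ∑ n ∈ B, ((((1 / 2 : ℝ) ^ j)⁻¹ : ℝ) • b n) • e n := by
          rw [Finset.smul_sum, ← Finset.sum_add_distrib]
          refine Finset.sum_congr rfl fun n _ => ?_
          rw [smul_smul, ← add_smul]
          congr 1
          rw [RCLike.real_smul_eq_coe_mul, ← mul_assoc, ← RCLike.ofReal_mul,
            mul_inv_cancel₀ hr0.ne']
          simp
        rw [h2]
        refine (hadd _ _).trans ?_
        rw [hN.smul, RCLike.norm_ofReal, abs_of_pos hr0, pow_succ]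
        set y := N (∑ n ∈ B, ((((1 / 2 : ℝ) ^ j)⁻¹ : ℝ) • b n) • e n)
        have h3 : κ * (1 / 2 : ℝ) ^ j * y ≤ 1 / 2 * y :=
          mul_le_mul_of_nonneg_right hr (hN.nonneg _)
        have h4 := mul_le_mul_of_nonneg_left hab hκ0.le
        linarith
    intro a ha
    have hlim := (tendsto_pow_atTop_nhds_zero_of_lt_one (show (0 : ℝ) ≤ 1 / 2 by norm_num)
      (by norm_num)).mul_const (κ ^ B.card * (B.card * c))
    replace hlim := hlim.const_add (2 * κ * K * realDemocracy 𝕜 N e B.card)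
    rw [zero_mul, add_zero] at hlim
    exact ge_of_tendsto' hlim fun i => hiter i a ha
  refine ⟨2 * κ * K + 1, by positivity, fun B a t ht ha => ?_⟩
  have hd := realDemocracy_nonneg (𝕜 := 𝕜) (N := N) (e := e) B.card
  have h1 := hunit B (fun n => ((t⁻¹ : ℝ) : 𝕜) * a n) fun n hn => by
    rw [norm_mul, RCLike.norm_ofReal, abs_of_pos (by positivity), inv_mul_le_iff₀ ht, mul_one]
    exact ha n hn
  have h2 : ∑ n ∈ B, a n • e n = (t : 𝕜) • ∑ n ∈ B, (((t⁻¹ : ℝ) : 𝕜) * a n) • e n := by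
    rw [Finset.smul_sum]
    refine Finset.sum_congr rfl fun n _ => ?_
    rw [smul_smul, ← mul_assoc, ← RCLike.ofReal_mul, mul_inv_cancel₀ ht.ne']
    simp
  rw [h2, hN.smul, RCLike.norm_ofReal, abs_of_pos ht]
  have h3 := mul_le_mul_of_nonneg_left h1 ht.le
  have h4 := mul_nonneg ht.le hd
  linarith

end Democracy

/-! ### From super-democracy to semi-greediness -/

section SemiGreedy

variable {𝕜 : Type*} [RCLike 𝕜] {X : Type*} [AddCommGroup X] [Module 𝕜 X] {N : X → ℝ}
  {e : ℕ → X} {es : ℕ → X →ₗ[𝕜] 𝕜}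

/-- Every indicator sum over `n` indices is comparable to the upper democracy function at `n`. -/
def IsSuperDemocratic (𝕜 : Type*) {X : Type*} [RCLike 𝕜] [AddCommGroup X] [Module 𝕜 X]
    (N : X → ℝ) (e : ℕ → X) : Prop :=
  ∃ C : ℝ, 0 < C ∧ ∀ (B : Finset ℕ) (ε : ℕ → 𝕜), (∀ k ∈ B, ‖ε k‖ = 1) →
    realDemocracy 𝕜 N e B.card ≤ C * N (indicatorSum e ε B)

theorem norm_ofReal_mul_sign (s : ℝ) (hs : 0 ≤ s) {z : 𝕜} (hz : z ≠ 0) :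
    ‖(s : 𝕜) * (((‖z‖⁻¹ : ℝ) : 𝕜) * z)‖ = s := by
  have : ‖z‖ ≠ 0 := norm_ne_zero_iff.2 hz
  simp [abs_of_nonneg hs, this]

theorem norm_ofReal_mul_sign_sub {s : ℝ} {z : 𝕜} (hz : z ≠ 0) (h : s ≤ ‖z‖) :
    ‖(s : 𝕜) * (((‖z‖⁻¹ : ℝ) : 𝕜) * z) - z‖ = ‖z‖ - s := by
  have h0 : 0 < ‖z‖ := norm_pos_iff.2 hz
  have h1 : (s : 𝕜) * (((‖z‖⁻¹ : ℝ) : 𝕜) * z) - z = ((s * ‖z‖⁻¹ - 1 : ℝ) : 𝕜) * z := by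
    push_cast; ring
  have h3 : s * ‖z‖⁻¹ - 1 ≤ 0 := by
    rw [sub_nonpos, mul_inv_le_iff₀ h0]; linarith
  rw [h1, norm_mul, RCLike.norm_ofReal, abs_of_nonpos h3]
  field_simp
  ring

/-- On a narrow band the coefficients are almost `s` times their signs. The error of this
replacement is at most `K δ s h_r(|D|)`, which super-democracy lets one absorb, and the projection
onto the band is a difference of two greedy projections. -/
theorem exists_band_bound (hN : IsQuasiBanach 𝕜 N) (hB : IsMBasis N e es)
    (hqg : IsQuasiGreedy N e es) (hsd : IsSuperDemocratic 𝕜 N e) :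
    ∃ ρ : ℝ, 1 < ρ ∧ ∃ C : ℝ, 0 < C ∧ ∀ (x : X) (s : ℝ), 0 < s → ∀ D : Finset ℕ,
      (∀ n, n ∈ D ↔ s ≤ ‖es n x‖ ∧ ‖es n x‖ < ρ * s) →
      s * realDemocracy 𝕜 N e D.card ≤ C * N x := by
  obtain ⟨κ, hκ, hadd, hsub⟩ := hN.exists_modulus
  have hκ0 : 0 < κ := by linarith
  obtain ⟨K, hK, hsum⟩ := hB.exists_sum_le_realDemocracy hN
  obtain ⟨Cd, hCd, hdem⟩ := hsd
  obtain ⟨Cp, hCp, hproj⟩ := hqg.exists_sum_le hN hB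
  have hCp0 : 0 < Cp := by linarith
  -- Chosen so that the absorbed term has coefficient exactly `1/2`.
  set δ : ℝ := 1 / (2 * Cd * κ * K) with hδ
  have hδ0 : 0 < δ := by positivity
  have hδ1 : Cd * κ * K * δ = 1 / 2 := by rw [hδ]; field_simp
  refine ⟨1 + δ, by linarith, 4 * Cd * κ ^ 2 * Cp, by positivity, fun x s hs D hD => ?_⟩
  have hs2 : 0 < (1 + δ) * s := by positivity
  have hG : ∀ t : ℝ, 0 < t → ∃ G : Finset ℕ, (∀ n, n ∈ G ↔ t ≤ ‖es n x‖) ∧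
      N (∑ n ∈ G, es n x • e n) ≤ Cp * N x := fun t ht => by
    have hmem : ∀ n, n ∈ (hB.finite_level hN x ht).toFinset ↔ t ≤ ‖es n x‖ := fun n => by simp
    refine ⟨_, hmem, hproj x _ fun i hi j hj => ?_⟩
    exact (not_le.1 (mt (hmem j).2 hj)).trans_le ((hmem i).1 hi)
  obtain ⟨G₁, hG₁, hG₁s⟩ := hG s hs
  obtain ⟨G₂, hG₂, hG₂s⟩ := hG _ hs2
  have hsubset : G₂ ⊆ G₁ := fun n hn => by
    rw [hG₂] at hn
    rw [hG₁]
    nlinarith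
  have hDG : D = G₁ \ G₂ := by
    ext n
    rw [hD, Finset.mem_sdiff, hG₁, hG₂, not_le]
  have hPD : N (∑ n ∈ D, es n x • e n) ≤ κ * (Cp * N x + Cp * N x) := by
    rw [hDG, Finset.sum_sdiff_eq_sub hsubset]
    refine (hsub _ _).trans ?_
    gcongr
  let ε : ℕ → 𝕜 := fun n => ((‖es n x‖⁻¹ : ℝ) : 𝕜) * es n x
  have hne : ∀ n ∈ D, es n x ≠ 0 := fun n hn =>
    norm_pos_iff.1 (hs.trans_le ((hD n).1 hn).1)
  have hε : ∀ n ∈ D, ‖ε n‖ = 1 := fun n hn => by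
    simpa [ε] using norm_ofReal_mul_sign (𝕜 := 𝕜) 1 zero_le_one (hne n hn)
  have hpert : N (∑ n ∈ D, ((s : 𝕜) * ε n - es n x) • e n) ≤
      K * (δ * s) * realDemocracy 𝕜 N e D.card := by
    refine hsum D _ _ (by positivity) fun n hn => ?_
    rw [norm_ofReal_mul_sign_sub (hne n hn) ((hD n).1 hn).1]
    have := ((hD n).1 hn).2
    linarith
  have hsplit : (s : 𝕜) • indicatorSum e ε D =
      ∑ n ∈ D, es n x • e n + ∑ n ∈ D, ((s : 𝕜) * ε n - es n x) • e n := by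
    rw [indicatorSum, Finset.smul_sum, ← Finset.sum_add_distrib]
    refine Finset.sum_congr rfl fun n _ => ?_
    rw [smul_smul, ← add_smul]; congr 1; ring
  have h1 : s * N (indicatorSum e ε D) ≤
      κ * (κ * (Cp * N x + Cp * N x) + K * (δ * s) * realDemocracy 𝕜 N e D.card) := by
    have h2 := hN.smul (s : 𝕜) (indicatorSum e ε D)
    rw [RCLike.norm_ofReal, abs_of_pos hs] at h2
    rw [← h2, hsplit]
    refine (hadd _ _).trans ?_
    gcongr
  have h2 := mul_le_mul_of_nonneg_left (hdem D ε hε) hs.le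
  have h3 := mul_le_mul_of_nonneg_left h1 hCd.le
  have h4 : Cd * (κ * (K * (δ * s) * realDemocracy 𝕜 N e D.card)) =
      1 / 2 * (s * realDemocracy 𝕜 N e D.card) := by
    rw [← hδ1]; ring
  nlinarith

/-- A band of ratio `ρ^k` is a stack of `k` narrow ones, and `h_r` is quasi-subadditive. -/
theorem exists_wide_band_bound (hN : IsQuasiBanach 𝕜 N) (hB : IsMBasis N e es)
    (hqg : IsQuasiGreedy N e es) (hsd : IsSuperDemocratic 𝕜 N e) (b₀ : ℝ) :
    ∃ b : ℝ, b₀ ≤ b ∧ ∃ C : ℝ, 0 ≤ C ∧ ∀ (x : X) (s : ℝ), 0 < s → ∀ D : Finset ℕ,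
      (∀ n, n ∈ D ↔ s ≤ ‖es n x‖ ∧ ‖es n x‖ < b * s) →
      s * realDemocracy 𝕜 N e D.card ≤ C * N x := by
  obtain ⟨κ, hκ, hadd, -⟩ := hN.exists_modulus
  have hκ0 : 0 < κ := by linarith
  obtain ⟨ρ, hρ, C₁, hC₁, hband⟩ := exists_band_bound hN hB hqg hsd
  obtain ⟨k, hk⟩ := pow_unbounded_of_one_lt b₀ hρ
  refine ⟨ρ ^ k, hk.le, ?_⟩
  clear hk
  induction k with
  | zero =>
    refine ⟨0, le_rfl, fun x s hs D hD => ?_⟩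
    have : D = ∅ := Finset.eq_empty_of_forall_notMem fun n hn => by
      have := (hD n).1 hn
      simp only [pow_zero, one_mul] at this
      linarith
    simp [this, realDemocracy_zero hN]
  | succ k ih =>
    obtain ⟨C, hC, h⟩ := ih
    refine ⟨κ * (C + C₁), by positivity, fun x s hs D hD => ?_⟩
    have hρk : 1 ≤ ρ ^ k := one_le_pow₀ hρ.le
    have h1 := h x s hs (D.filter fun n => ‖es n x‖ < ρ ^ k * s) fun n => by
      rw [Finset.mem_filter, hD, and_assoc]
      refine and_congr_right fun _ => ⟨fun h => h.2, fun h => ⟨h.trans_le ?_, h⟩⟩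
      gcongr
      · exact hρ.le
      · exact k.le_succ
    have h2 := hband x (ρ ^ k * s) (by positivity) (D.filter fun n => ¬ ‖es n x‖ < ρ ^ k * s)
      fun n => by
        rw [Finset.mem_filter, hD, not_lt, pow_succ', mul_assoc]
        refine ⟨fun h => ⟨h.2, h.1.2⟩, fun h => ⟨⟨?_, h.2⟩, h.1⟩⟩
        nlinarith [h.1]
    have h3 := hB.realDemocracy_add_le hN hκ hadd (D.filter fun n => ‖es n x‖ < ρ ^ k * s).card
      (D.filter fun n => ¬ ‖es n x‖ < ρ ^ k * s).card
    rw [Finset.card_filter_add_card_filter_not] at h3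
    set d₁ := realDemocracy 𝕜 N e (D.filter fun n => ‖es n x‖ < ρ ^ k * s).card
    set d₂ := realDemocracy 𝕜 N e (D.filter fun n => ¬ ‖es n x‖ < ρ ^ k * s).card
    have hd₂ : 0 ≤ d₂ := realDemocracy_nonneg _
    have h4 : s * d₂ ≤ ρ ^ k * s * d₂ := by
      have := mul_nonneg hs.le hd₂
      nlinarith
    calc _ ≤ s * (κ * (d₁ + d₂)) := mul_le_mul_of_nonneg_left h3 hs.le
      _ = κ * (s * d₁ + s * d₂) := by ring
      _ ≤ κ * (C * N x + C₁ * N x) :=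
        mul_le_mul_of_nonneg_left (add_le_add h1 (h4.trans h2)) hκ0.le
      _ = _ := by ring

/-- The large coefficients of `x` are controlled by the quasi-norm of `x`. -/
theorem exists_level_bound (hN : IsQuasiBanach 𝕜 N) (hB : IsMBasis N e es)
    (hqg : IsQuasiGreedy N e es) (hsd : IsSuperDemocratic 𝕜 N e) :
    ∃ C : ℝ, 0 ≤ C ∧ ∀ (x : X) (s : ℝ), 0 < s → ∀ G : Finset ℕ,
      (∀ n, n ∈ G ↔ s ≤ ‖es n x‖) → s * realDemocracy 𝕜 N e G.card ≤ C * N x := by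
  obtain ⟨κ, hκ, hadd, -⟩ := hN.exists_modulus
  have hκ0 : 0 < κ := by linarith
  -- With ratio `b ≥ 2κ`, peeling off the lowest band bounds the value at `s` by `κC‖x‖` plus half
  -- the value at `bs`. The constant `2κC` therefore survives any number of peelings.
  obtain ⟨b, hb, C, hC, hband⟩ := exists_wide_band_bound hN hB hqg hsd (2 * κ)
  obtain ⟨c, hc, -, hes⟩ := hB.exists_bound hN
  have hb1 : 1 < b := by linarith
  refine ⟨2 * κ * C, by positivity, fun x s hs => ?_⟩
  obtain ⟨j, hj⟩ := pow_unbounded_of_one_lt (c * N x / s) hb1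
  have hbdd : ∀ n, ‖es n x‖ < b ^ j * s := fun n => by
    rw [div_lt_iff₀ hs] at hj
    exact (hes n x).trans_lt hj
  clear hj
  have hx := hN.nonneg x
  induction j generalizing s with
  | zero =>
    intro G hG
    have : G = ∅ := Finset.eq_empty_of_forall_notMem fun n hn => by
      have h1 := (hG n).1 hn
      have h2 := hbdd n
      simp only [pow_zero, one_mul] at h2
      linarith
    rw [this, Finset.card_empty, realDemocracy_zero hN, mul_zero]
    positivity
  | succ j ih =>
    intro G hG
    have h1 := hband x s hs (G.filter fun n => ‖es n x‖ < b * s) fun n => by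
      rw [Finset.mem_filter, hG]
    have h2 := ih (b * s) (by positivity) (fun n => by
      rw [← mul_assoc, ← pow_succ]; exact hbdd n) (G.filter fun n => ¬ ‖es n x‖ < b * s) fun n => by
        rw [Finset.mem_filter, hG, not_lt]
        exact ⟨fun h => h.2, fun h => ⟨by nlinarith, h⟩⟩
    have h3 := hB.realDemocracy_add_le hN hκ hadd (G.filter fun n => ‖es n x‖ < b * s).card
      (G.filter fun n => ¬ ‖es n x‖ < b * s).card
    rw [Finset.card_filter_add_card_filter_not] at h3
    set d₁ := realDemocracy 𝕜 N e (G.filter fun n => ‖es n x‖ < b * s).card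
    set d₂ := realDemocracy 𝕜 N e (G.filter fun n => ¬ ‖es n x‖ < b * s).card
    have hd₂ : 0 ≤ d₂ := realDemocracy_nonneg _
    have h4 : 2 * κ * (s * d₂) ≤ b * s * d₂ := by
      have := mul_nonneg hs.le hd₂
      nlinarith
    calc _ ≤ s * (κ * (d₁ + d₂)) := mul_le_mul_of_nonneg_left h3 hs.le
      _ = κ * (s * d₁) + κ * (s * d₂) := by ring
      _ ≤ κ * (C * N x) + κ * C * N x :=
        add_le_add (mul_le_mul_of_nonneg_left h1 hκ0.le) (by linarith)
      _ = _ := by ring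

/-- Let `A` be the greedy set and `α` the largest modulus left outside it. Truncate `z = x - ∑ b_n
e_n` at height `α`, then restore the coefficients of `x` on `B \ A`. The result agrees with `x` off
`A`, hence is a Chebyshev residual. Both changes are paid for by the level bound at `α`, as `|B \ A|
= |A \ B|` and on `A \ B` the coefficients of `z` are those of `x`, of modulus at least `α`. -/
theorem exists_chebyshev_bound (hN : IsQuasiBanach 𝕜 N) (hB : IsMBasis N e es)
    (hqg : IsQuasiGreedy N e es) (hsd : IsSuperDemocratic 𝕜 N e) :
    ∃ C : ℝ, 0 < C ∧ ∀ (x : X) (π : ℕ → ℕ), IsGreedyOrdering es x π →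
      ∀ (B : Finset ℕ) (b : ℕ → 𝕜), ∃ a : ℕ → 𝕜,
        N (x - ∑ i ∈ Finset.range B.card, a i • e (π i)) ≤ C * N (x - ∑ n ∈ B, b n • e n) := by
  obtain ⟨κ, hκ, hadd, -⟩ := hN.exists_modulus
  have hκ0 : 0 < κ := by linarith
  obtain ⟨K, hK, hsum⟩ := hB.exists_sum_le_realDemocracy hN
  obtain ⟨Cq, hCq, hcompl⟩ := hqg.exists_sub_sum_le hN hB
  obtain ⟨C₁, hC₁, hlevel⟩ := exists_level_bound hN hB hqg hsd
  refine ⟨κ * (κ * (Cq + K * C₁) + 2 * K * C₁), by positivity, fun x π hπ B b => ?_⟩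
  set z : X := x - ∑ n ∈ B, b n • e n with hz
  have hNz := hN.nonneg z
  set A := (Finset.range B.card).image π with hA
  have hAcard : A.card = B.card := by
    rw [hA, Finset.card_image_of_injective _ hπ.injective, Finset.card_range]
  have hzx : ∀ n ∉ B, es n z = es n x := fun n hn => by
    rw [hz, map_sub, hB.coeff_sum, if_neg hn, sub_zero]
  set α : ℝ := ‖es (π B.card) x‖ with hα
  have hout : ∀ n ∉ A, ‖es n x‖ ≤ α := by
    intro n hn
    by_cases h0 : es n x = 0
    · rw [h0, norm_zero]; exact norm_nonneg _
    · obtain ⟨i, rfl⟩ := hπ.support_subset h0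
      refine hπ.decreasing _ _ (le_of_not_gt fun h => hn ?_)
      exact Finset.mem_image_of_mem _ (Finset.mem_range.2 h)
  have hin : ∀ n ∈ A, α ≤ ‖es n x‖ := by
    intro n hn
    obtain ⟨i, hi, rfl⟩ := Finset.mem_image.1 hn
    exact hπ.decreasing _ _ (Finset.mem_range.1 hi).le
  have hkey : ∀ w : X, (∀ n ∉ A, es n w = es n x) →
      x - ∑ i ∈ Finset.range B.card, es (π i) (x - w) • e (π i) = w := by
    intro w hw
    rw [← hπ.sum_range B.card (fun n => es n (x - w) • e n), ← hA, ← sub_eq_zero]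
    refine hB.total _ fun n => ?_
    rw [map_sub, map_sub, hB.coeff_sum]
    split_ifs with hn
    · rw [map_sub]; ring
    · rw [hw n hn]; ring
  rcases (norm_nonneg (es (π B.card) x)).eq_or_lt with h0 | h0
  -- If `α = 0` then `x` is supported in `A`, and the residual `0` is attained.
  · refine ⟨fun i => es (π i) (x - 0), ?_⟩
    rw [hkey 0 fun n hn => ?_, hN.map_zero]
    · positivity
    · rw [map_zero, eq_comm, ← norm_le_zero_iff, h0]
      exact hout n hn
  · rw [← hα] at h0
    set G := (hB.finite_level hN z h0).toFinset with hG
    have hGmem : ∀ n, n ∈ G ↔ α ≤ ‖es n z‖ := fun n => by simp [hG]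
    set G' := G.filter fun n => α < ‖es n z‖ with hG'
    have hG'mem : ∀ n, n ∈ G' ↔ α < ‖es n z‖ := fun n => by
      rw [hG', Finset.mem_filter, hGmem]
      exact ⟨fun h => h.2, fun h => ⟨h.le, h⟩⟩
    have hαG : α * realDemocracy 𝕜 N e G.card ≤ C₁ * N z := hlevel z α h0 G hGmem
    let σ : ℕ → 𝕜 := fun n => (α : 𝕜) * (((‖es n z‖⁻¹ : ℝ) : 𝕜) * es n z)
    have hσ : ∀ n ∈ G', ‖σ n‖ = α := fun n hn =>
      norm_ofReal_mul_sign _ h0.le (norm_pos_iff.1 (h0.trans ((hG'mem n).1 hn)))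
    set T : X := z - ∑ n ∈ G', es n z • e n + ∑ n ∈ G', σ n • e n with hT
    have hTcoeff : ∀ n, es n T = if n ∈ G' then σ n else es n z := fun n => by
      rw [hT, map_add, map_sub, hB.coeff_sum, hB.coeff_sum]
      split_ifs <;> ring
    have hTle : ∀ n, ‖es n T‖ ≤ α := fun n => by
      rw [hTcoeff]
      split_ifs with hn
      · exact (hσ n hn).le
      · exact not_lt.1 (mt (hG'mem n).2 hn)
    have hTN : N T ≤ κ * (Cq + K * C₁) * N z := by
      have h1 : N (z - ∑ n ∈ G', es n z • e n) ≤ Cq * N z :=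
        hcompl z G' fun i hi j hj => by
          rw [hG'mem] at hi hj
          exact (not_lt.1 hj).trans_lt hi
      have h2 : N (∑ n ∈ G', σ n • e n) ≤ K * (C₁ * N z) := by
        refine (hsum G' σ α h0 fun n hn => (hσ n hn).le).trans ?_
        have h3 : realDemocracy 𝕜 N e G'.card ≤ realDemocracy 𝕜 N e G.card :=
          hB.realDemocracy_mono hN (Finset.card_filter_le _ _)
        rw [mul_assoc]
        exact mul_le_mul_of_nonneg_left ((mul_le_mul_of_nonneg_left h3 h0.le).trans hαG) hK.le
      calc N T ≤ κ * (Cq * N z + K * (C₁ * N z)) := (hadd _ _).trans (by gcongr)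
        _ = _ := by ring
    set w : X := T + ∑ n ∈ B \ A, es n (x - T) • e n with hw
    have hwN : N w ≤ κ * (κ * (Cq + K * C₁) + 2 * K * C₁) * N z := by
      have h1 : N (∑ n ∈ B \ A, es n (x - T) • e n) ≤ K * (2 * (C₁ * N z)) := by
        refine (hsum (B \ A) (fun n => es n (x - T)) (2 * α) (by positivity) fun n hn => ?_).trans ?_
        · rw [map_sub]
          have h2 := norm_sub_le (es n x) (es n T)
          have h3 := hout n (Finset.mem_sdiff.1 hn).2
          have h4 := hTle n
          linarith
        · have h2 : (B \ A).card ≤ G.card := by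
            rw [Finset.card_sdiff_comm hAcard.symm]
            refine Finset.card_le_card fun n hn => ?_
            rw [Finset.mem_sdiff] at hn
            rw [hGmem, hzx n hn.2]
            exact hin n hn.1
          have h3 := hB.realDemocracy_mono hN (𝕜 := 𝕜) h2
          rw [mul_assoc, mul_assoc]
          exact mul_le_mul_of_nonneg_left (mul_le_mul_of_nonneg_left
            ((mul_le_mul_of_nonneg_left h3 h0.le).trans hαG) zero_le_two) hK.le
      calc N w ≤ κ * (κ * (Cq + K * C₁) * N z + K * (2 * (C₁ * N z))) :=
            (hadd _ _).trans (by gcongr)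
        _ = _ := by ring
    refine ⟨fun i => es (π i) (x - w), ?_⟩
    rw [hkey w fun n hn => ?_]
    · exact hwN
    · rw [hw, map_add, hB.coeff_sum]
      by_cases hnB : n ∈ B
      · rw [if_pos (Finset.mem_sdiff.2 ⟨hnB, hn⟩), map_sub]; ring
      -- Off `A ∪ B` the coefficient is that of `x`, at most `α`, so truncation left it alone.
      · have h1 : n ∉ G' := by
          rw [hG'mem, hzx n hnB, not_lt]; exact hout n hn
        rw [if_neg fun h => hnB (Finset.mem_sdiff.1 h).1, hTcoeff, if_neg h1, hzx n hnB, add_zero]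

theorem IsSuperDemocratic.isSemiGreedy (hN : IsQuasiBanach 𝕜 N) (hB : IsMBasis N e es)
    (hqg : IsQuasiGreedy N e es) (hsd : IsSuperDemocratic 𝕜 N e) : IsSemiGreedy N e es := by
  obtain ⟨C, hC, h⟩ := exists_chebyshev_bound hN hB hqg hsd
  refine ⟨C, hC, fun m x _ => iSup₂_le fun π hπ => ?_⟩
  -- The constant is moved to the left to expose the infimum, and back once `B` and `b` are fixed.
  rw [← ENNReal.div_le_iff' (by simpa using hC) ENNReal.ofReal_ne_top]
  refine le_iInf fun B => le_iInf fun hBm => le_iInf fun b => ?_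
  rw [ENNReal.div_le_iff' (by simpa using hC) ENNReal.ofReal_ne_top, ← ENNReal.ofReal_mul hC.le]
  obtain ⟨a, ha⟩ := h x π hπ B b
  rw [hBm] at ha
  exact iInf_le_of_le a (ENNReal.ofReal_le_ofReal ha)

end SemiGreedy

/-! ### Doubling weights and estimates of the error quasi-norms -/

section Weights

variable {ω : ℕ → ℝ}

theorem IsDoublingWeight.pos_of_one_le (hω : IsDoublingWeight ω) {n : ℕ} (hn : 1 ≤ n) : 0 < ω n :=
  hω.pos.trans_le (hω.mono 1 n le_rfl hn)

theorem IsDoublingWeight.exists_dilation (hω : IsDoublingWeight ω)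
    (hi : 0 < lowerDilationIndex ω) :
    ∃ (M : ℕ) (φ : ℝ), 1 < M ∧ 1 < φ ∧ ∀ k, 1 ≤ k → φ * ω k ≤ ω (M * k) := by
  obtain ⟨M, hM⟩ := lt_iSup_iff.1 hi
  obtain ⟨hM1, hM⟩ := lt_iSup_iff.1 hM
  have hpos : ∀ k : ℕ, 0 ≤ ω (M * (k + 1)) / ω (k + 1) := fun k =>
    div_nonneg (hω.pos_of_one_le (Nat.mul_pos (by omega) k.succ_pos)).le
      (hω.pos_of_one_le k.succ_pos).le
  have hφ0 : 0 ≤ lowerDilation ω M := le_ciInf hpos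
  have hlogM : 0 < Real.log M := Real.log_pos (by exact_mod_cast hM1)
  have hlog : 0 < Real.log (lowerDilation ω M) := by
    have h : 0 < Real.log (lowerDilation ω M) / Real.log M := by exact_mod_cast hM
    exact (div_pos_iff_of_pos_right hlogM).1 h
  refine ⟨M, lowerDilation ω M, hM1, ?_, fun k hk => ?_⟩
  · by_contra h
    exact absurd (Real.log_nonpos hφ0 (not_lt.1 h)) (not_le.2 hlog)
  · obtain ⟨k, rfl⟩ := Nat.exists_eq_add_of_le' hk
    rw [← le_div_iff₀ (hω.pos_of_one_le k.succ_pos)]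
    exact ciInf_le ⟨0, by rintro _ ⟨j, rfl⟩; exact hpos j⟩ k

theorem IsDoublingWeight.exists_dilation_ge (hω : IsDoublingWeight ω)
    (hi : 0 < lowerDilationIndex ω) (c : ℝ) :
    ∃ M : ℕ, 1 ≤ M ∧ ∀ k, 1 ≤ k → c * ω k ≤ ω (M * k) := by
  obtain ⟨M, φ, hM, hφ, h⟩ := hω.exists_dilation hi
  obtain ⟨j, hj⟩ := pow_unbounded_of_one_lt c hφ
  have hiter : ∀ j k, 1 ≤ k → φ ^ j * ω k ≤ ω (M ^ j * k) := by
    intro j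
    induction j with
    | zero => simp
    | succ j ih =>
      intro k hk
      have h1 := h (M ^ j * k) (Nat.mul_pos (pow_pos (by omega) j) hk)
      rw [← mul_assoc, ← pow_succ'] at h1
      refine le_trans ?_ h1
      rw [pow_succ', mul_assoc]
      exact mul_le_mul_of_nonneg_left (ih k hk) (by linarith)
  refine ⟨M ^ j, Nat.pow_pos (by omega), fun k hk => le_trans ?_ (hiter j k hk)⟩
  exact mul_le_mul_of_nonneg_right hj.le (hω.pos_of_one_le hk).le

/-- Cut at `n / M`: by induction the lower part gains the factor `φ^{-p}`, while each term of the
upper part is at most `ω(n)^p M/n`. The constant solves `C φ^{-p} + M = C`. -/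
theorem IsDoublingWeight.exists_sum_rpow_le (hω : IsDoublingWeight ω)
    (hi : 0 < lowerDilationIndex ω) {p : ℝ} (hp : 0 < p) :
    ∃ C : ℝ, 0 < C ∧ ∀ n, 1 ≤ n →
      ∑ k ∈ Finset.range n, ω (k + 1) ^ p / (k + 1 : ℕ) ≤ C * ω n ^ p := by
  obtain ⟨M, φ, hM, hφ, h⟩ := hω.exists_dilation hi
  have hφp : (φ ^ p)⁻¹ < 1 := inv_lt_one_of_one_lt₀ (Real.one_lt_rpow hφ hp)
  have hφp0 : 0 < φ ^ p := Real.rpow_pos_of_pos (by linarith) p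
  have hM0 : (0 : ℝ) < M := by exact_mod_cast (by omega : 0 < M)
  have hden : 0 < 1 - (φ ^ p)⁻¹ := by linarith
  refine ⟨M / (1 - (φ ^ p)⁻¹), by positivity, fun n => ?_⟩
  set C := M / (1 - (φ ^ p)⁻¹) with hC
  have hC0 : 0 < C := by positivity
  have hCeq : C * (φ ^ p)⁻¹ + M = C := by
    have : C * (1 - (φ ^ p)⁻¹) = M := div_mul_cancel₀ _ hden.ne'
    linarith
  induction n using Nat.strong_induction_on with
  | _ n ih =>
    intro hn
    have hωn := hω.pos_of_one_le hn
    have hn0 : (0 : ℝ) < n := by exact_mod_cast hn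
    have hωp : 0 < ω n ^ p := Real.rpow_pos_of_pos hωn p
    have hr : n / M < n := Nat.div_lt_self hn hM
    rw [← Finset.sum_range_add_sum_Ico _ hr.le]
    have h1 : ∑ k ∈ Finset.range (n / M), ω (k + 1) ^ p / (k + 1 : ℕ) ≤
        C * (φ ^ p)⁻¹ * ω n ^ p := by
      rcases Nat.eq_zero_or_pos (n / M) with h0 | h0
      · rw [h0, Finset.sum_range_zero]; positivity
      · refine (ih _ hr h0).trans ?_
        rw [mul_assoc]
        refine mul_le_mul_of_nonneg_left ?_ hC0.le
        rw [le_inv_mul_iff₀ hφp0, ← Real.mul_rpow (by linarith) (hω.pos_of_one_le h0).le]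
        refine Real.rpow_le_rpow (mul_nonneg (by linarith) (hω.pos_of_one_le h0).le) ?_ hp.le
        exact (h _ h0).trans (hω.mono _ _ (Nat.mul_pos (by omega) h0) (Nat.mul_div_le n M))
    have h2 : ∑ k ∈ Finset.Ico (n / M) n, ω (k + 1) ^ p / (k + 1 : ℕ) ≤ M * ω n ^ p := by
      have hterm : ∀ k ∈ Finset.Ico (n / M) n,
          ω (k + 1) ^ p / (k + 1 : ℕ) ≤ ω n ^ p * (M / n) := by
        intro k hk
        rw [Finset.mem_Ico] at hk
        rw [div_eq_mul_inv]
        have hk' : n ≤ M * (k + 1) := by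
          have := Nat.lt_mul_div_succ n (show 0 < M by omega)
          exact this.le.trans (Nat.mul_le_mul_left M (by omega))
        have hk'' : (n : ℝ) ≤ M * (k + 1 : ℕ) := by exact_mod_cast hk'
        gcongr
        · exact (hω.pos_of_one_le k.succ_pos).le
        · exact hω.mono _ _ k.succ_pos (by omega)
        · rw [le_div_iff₀ hn0, inv_mul_le_iff₀ (by positivity), mul_comm]
          exact hk''
      refine (Finset.sum_le_card_nsmul _ _ _ hterm).trans ?_
      rw [Nat.card_Ico, nsmul_eq_mul]
      have hcard : ((n - n / M : ℕ) : ℝ) ≤ n := by exact_mod_cast Nat.sub_le _ _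
      calc _ ≤ (n : ℝ) * (ω n ^ p * (M / n)) := by gcongr
        _ = _ := by field_simp
    calc _ ≤ C * (φ ^ p)⁻¹ * ω n ^ p + M * ω n ^ p := add_le_add h1 h2
      _ = (C * (φ ^ p)⁻¹ + M) * ω n ^ p := by ring
      _ = _ := by rw [hCeq]

theorem IsDoublingWeight.exists_le_sum_rpow (hω : IsDoublingWeight ω) {p : ℝ} (hp : 0 < p) :
    ∃ c : ℝ, 0 < c ∧ ∀ n, 1 ≤ n →
      c * ω n ^ p ≤ ∑ k ∈ Finset.range n, ω (k + 1) ^ p / (k + 1 : ℕ) := by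
  obtain ⟨θ, hθ, hdbl⟩ := hω.doubling
  have hθ0 : 0 < θ := by linarith
  have hθp : 0 < θ ^ p := Real.rpow_pos_of_pos hθ0 p
  refine ⟨(θ ^ p)⁻¹ / 2, by positivity, fun n hn => ?_⟩
  have hn0 : (0 : ℝ) < n := by exact_mod_cast hn
  have hωn := hω.pos_of_one_le hn
  -- These are the `k` with `n/2 ≤ k + 1 ≤ n`, where doubling gives `ω(n) ≤ θ ω(k + 1)`.
  have hsub : Finset.Ico ((n + 1) / 2 - 1) n ⊆ Finset.range n := fun k hk => by
    rw [Finset.mem_Ico] at hk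
    exact Finset.mem_range.2 hk.2
  have hnn : ∀ k : ℕ, 0 ≤ ω (k + 1) ^ p / (k + 1 : ℕ) := fun k =>
    div_nonneg (Real.rpow_nonneg (hω.pos_of_one_le k.succ_pos).le p) (Nat.cast_nonneg _)
  refine le_trans ?_ (Finset.sum_le_sum_of_subset_of_nonneg hsub fun k _ _ => hnn k)
  have hterm : ∀ k ∈ Finset.Ico ((n + 1) / 2 - 1) n,
      (θ ^ p)⁻¹ * ω n ^ p / n ≤ ω (k + 1) ^ p / (k + 1 : ℕ) := by
    intro k hk
    rw [Finset.mem_Ico] at hk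
    have h1 : ω n ≤ θ * ω (k + 1) :=
      (hω.mono _ _ hn (by omega)).trans (hdbl (k + 1) k.succ_pos)
    have h2 : (θ ^ p)⁻¹ * ω n ^ p ≤ ω (k + 1) ^ p := by
      rw [inv_mul_le_iff₀ hθp, ← Real.mul_rpow hθ0.le (hω.pos_of_one_le k.succ_pos).le]
      exact Real.rpow_le_rpow hωn.le h1 hp.le
    have h3 : ((k + 1 : ℕ) : ℝ) ≤ n := by exact_mod_cast hk.2
    have h4 := Real.rpow_nonneg (hω.pos_of_one_le k.succ_pos).le p
    gcongr
  refine le_trans ?_ (Finset.card_nsmul_le_sum _ _ _ hterm)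
  rw [Nat.card_Ico, nsmul_eq_mul]
  have hcard : (n : ℝ) / 2 ≤ (n - ((n + 1) / 2 - 1) : ℕ) := by
    rw [div_le_iff₀ two_pos]
    exact_mod_cast (by omega : n ≤ (n - ((n + 1) / 2 - 1)) * 2)
  have hωp : 0 < ω n ^ p := Real.rpow_pos_of_pos hωn p
  calc _ = (n : ℝ) / 2 * ((θ ^ p)⁻¹ * ω n ^ p / n) := by field_simp
    _ ≤ _ := by gcongr

theorem ofReal_mul_rpow_div {a b p : ℝ} (ha : 0 ≤ a) (hb : 0 ≤ b) (hp : 0 ≤ p) (k : ℕ) :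
    (ENNReal.ofReal a * ENNReal.ofReal b) ^ p / ((k + 1 : ℕ) : ℝ≥0∞) =
      ENNReal.ofReal (b ^ p * (a ^ p / (k + 1 : ℕ))) := by
  rw [← ENNReal.ofReal_mul ha, ENNReal.ofReal_rpow_of_nonneg (by positivity) hp,
    ← ENNReal.ofReal_natCast, ← ENNReal.ofReal_div_of_pos (by positivity), Real.mul_rpow ha hb]
  congr 1
  ring

variable {X : Type*}

/-- The condition `1 ≤ C` accommodates the summand `‖x‖`, common to both sides. -/
theorem errorQNorm_mono {N : X → ℝ} {q : ℝ≥0∞} (hq : 0 < q) {E F : ℕ → X → ℝ≥0∞} {C : ℝ≥0∞}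
    (hC : 1 ≤ C) (x : X) (h : ∀ n, E (n + 1) x ≤ C * F (n + 1) x) :
    errorQNorm N ω q E x ≤ C * errorQNorm N ω q F x := by
  have hterm : ∀ n, ENNReal.ofReal (ω (n + 1)) * E (n + 1) x ≤
      C * (ENNReal.ofReal (ω (n + 1)) * F (n + 1) x) := fun n => by
    rw [mul_left_comm]
    gcongr
    exact h n
  rw [errorQNorm, errorQNorm, mul_add]
  refine add_le_add (le_mul_of_one_le_left' hC) ?_
  split_ifs with hq'
  · rw [ENNReal.mul_iSup]
    exact iSup_mono hterm
  · have hp : 0 < q.toReal := ENNReal.toReal_pos hq.ne' hq'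
    have h1 : C = (C ^ q.toReal) ^ (1 / q.toReal) := by
      rw [← ENNReal.rpow_mul, mul_one_div_cancel hp.ne', ENNReal.rpow_one]
    conv_rhs => rw [h1, ← ENNReal.mul_rpow_of_nonneg _ _ (by positivity), ← ENNReal.tsum_mul_left]
    refine ENNReal.rpow_le_rpow (ENNReal.tsum_le_tsum fun n => ?_) (by positivity)
    rw [← mul_div_assoc, ← ENNReal.mul_rpow_of_nonneg _ _ hp.le]
    exact ENNReal.div_le_div_right (ENNReal.rpow_le_rpow (hterm n) hp.le) _

theorem ContEmbeds.of_le {ν μ : X → ℝ≥0∞} {C : ℝ} (hC : 0 < C)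
    (h : ∀ x, μ x ≤ ENNReal.ofReal C * ν x) : ContEmbeds ν μ :=
  ⟨fun x hx => (h x).trans_lt (ENNReal.mul_lt_top ENNReal.ofReal_lt_top hx), C, hC, fun x _ => h x⟩

/-- Meant for an error profile with two plateaus, `U` then `V`, followed by zero. Weighted sums are
dominated by their last term, so the plateaus cost `U ω(d)` and `V ω(2n)`. -/
theorem IsDoublingWeight.exists_errorQNorm_le (hω : IsDoublingWeight ω)
    (hi : 0 < lowerDilationIndex ω) {q : ℝ≥0∞} (hq : 0 < q) :
    ∃ C : ℝ, 0 < C ∧ ∀ (N : X → ℝ) (E : ℕ → X → ℝ≥0∞) (x : X) (U V : ℝ) (d n : ℕ),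
      0 ≤ N x → 0 ≤ U → 0 ≤ V → 1 ≤ d → d ≤ n →
      (∀ k < d, E (k + 1) x ≤ ENNReal.ofReal U) →
      (∀ k, d ≤ k → k < 2 * n → E (k + 1) x ≤ ENNReal.ofReal V) →
      (∀ k, 2 * n ≤ k → E (k + 1) x = 0) →
      errorQNorm N ω q E x ≤ ENNReal.ofReal (N x + C * (U * ω d + V * ω n)) := by
  obtain ⟨θ, hθ, hdbl⟩ := hω.doubling
  have hθ0 : 0 < θ := by linarith
  by_cases hq' : q = ∞
  · refine ⟨θ, hθ0, fun N E x U V d n hx hU hV hd hdn h1 h2 h3 => ?_⟩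
    have hωd := (hω.pos_of_one_le hd).le
    have hωn := (hω.pos_of_one_le (hd.trans hdn)).le
    rw [errorQNorm, if_pos hq', ENNReal.ofReal_add hx (by positivity)]
    gcongr
    refine iSup_le fun k => ?_
    have hωk := (hω.pos_of_one_le k.succ_pos).le
    have hUd := mul_nonneg hU hωd
    have hVn := mul_nonneg hV hωn
    rcases lt_or_ge k d with hk | hk
    · refine (mul_le_mul_right (h1 k hk) _).trans ?_
      rw [← ENNReal.ofReal_mul hωk]
      refine ENNReal.ofReal_le_ofReal ?_
      have := mul_le_mul_of_nonneg_left (hω.mono (k + 1) d k.succ_pos hk) hU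
      nlinarith
    rcases lt_or_ge k (2 * n) with hk' | hk'
    · refine (mul_le_mul_right (h2 k hk hk') _).trans ?_
      rw [← ENNReal.ofReal_mul hωk]
      refine ENNReal.ofReal_le_ofReal ?_
      have := mul_le_mul_of_nonneg_left ((hω.mono (k + 1) (2 * n) k.succ_pos hk').trans
        (hdbl n (hd.trans hdn))) hV
      nlinarith
    · simp [h3 k hk']
  · have hp : 0 < q.toReal := ENNReal.toReal_pos hq.ne' hq'
    set p := q.toReal with hpdef
    obtain ⟨C, hC, hsum⟩ := hω.exists_sum_rpow_le hi hp
    refine ⟨(2 * C) ^ (1 / p) * θ, by positivity,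
      fun N E x U V d n hx hU hV hd hdn h1 h2 h3 => ?_⟩
    have hωd := (hω.pos_of_one_le hd).le
    have hn : 1 ≤ n := hd.trans hdn
    have hωn := (hω.pos_of_one_le hn).le
    have hω2n := (hω.pos_of_one_le (show 1 ≤ 2 * n by omega)).le
    rw [errorQNorm, if_neg hq', ENNReal.ofReal_add hx (by positivity), ← hpdef]
    gcongr
    rw [tsum_eq_sum (s := Finset.range (2 * n)) fun k hk => by
      rw [h3 k (by simpa using hk), mul_zero, ENNReal.zero_rpow_of_pos hp, ENNReal.zero_div]]
    have hw : ∀ k : ℕ, 0 ≤ ω (k + 1) ^ p / (k + 1 : ℕ) := fun k =>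
      div_nonneg (Real.rpow_nonneg (hω.pos_of_one_le k.succ_pos).le p) (Nat.cast_nonneg _)
    have hUp := Real.rpow_nonneg hU p
    have hVp := Real.rpow_nonneg hV p
    have hbound : ∀ (s : Finset ℕ) (W : ℝ), 0 ≤ W →
        (∀ k ∈ s, E (k + 1) x ≤ ENNReal.ofReal W) →
        ∑ k ∈ s, (ENNReal.ofReal (ω (k + 1)) * E (k + 1) x) ^ p / ((k + 1 : ℕ) : ℝ≥0∞) ≤
          ENNReal.ofReal (W ^ p * ∑ k ∈ s, ω (k + 1) ^ p / (k + 1 : ℕ)) := by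
      intro s W hW hs
      rw [Finset.mul_sum, ENNReal.ofReal_sum_of_nonneg fun k _ =>
        mul_nonneg (Real.rpow_nonneg hW p) (hw k)]
      refine Finset.sum_le_sum fun k hk => ?_
      rw [← ofReal_mul_rpow_div (hω.pos_of_one_le k.succ_pos).le hW hp.le]
      gcongr
      exact hs k hk
    have htotal : ∑ k ∈ Finset.range (2 * n),
        (ENNReal.ofReal (ω (k + 1)) * E (k + 1) x) ^ p / ((k + 1 : ℕ) : ℝ≥0∞) ≤
        ENNReal.ofReal (2 * C * (U * ω d + V * ω (2 * n)) ^ p) := by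
      rw [← Finset.sum_range_add_sum_Ico _ (show d ≤ 2 * n by omega)]
      refine (add_le_add (hbound _ U hU fun k hk => h1 k (Finset.mem_range.1 hk))
        (hbound _ V hV fun k hk => h2 k (Finset.mem_Ico.1 hk).1 (Finset.mem_Ico.1 hk).2)).trans ?_
      rw [← ENNReal.ofReal_add (mul_nonneg hUp (Finset.sum_nonneg fun k _ => hw k))
        (mul_nonneg hVp (Finset.sum_nonneg fun k _ => hw k))]
      refine ENNReal.ofReal_le_ofReal ?_
      have h4 : ∑ k ∈ Finset.Ico d (2 * n), ω (k + 1) ^ p / (k + 1 : ℕ) ≤ C * ω (2 * n) ^ p :=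
        (Finset.sum_le_sum_of_subset_of_nonneg (fun k hk => Finset.mem_range.2
          (Finset.mem_Ico.1 hk).2) fun k _ _ => hw k).trans (hsum (2 * n) (by omega))
      have h5 : (U * ω d) ^ p ≤ (U * ω d + V * ω (2 * n)) ^ p :=
        Real.rpow_le_rpow (by positivity) (le_add_of_nonneg_right (by positivity)) hp.le
      have h6 : (V * ω (2 * n)) ^ p ≤ (U * ω d + V * ω (2 * n)) ^ p :=
        Real.rpow_le_rpow (by positivity) (le_add_of_nonneg_left (by positivity)) hp.le
      calc _ ≤ U ^ p * (C * ω d ^ p) + V ^ p * (C * ω (2 * n) ^ p) := by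
            gcongr
            exact hsum d hd
        _ = C * ((U * ω d) ^ p + (V * ω (2 * n)) ^ p) := by
            rw [Real.mul_rpow hU hωd, Real.mul_rpow hV hω2n]; ring
        _ ≤ C * ((U * ω d + V * ω (2 * n)) ^ p + (U * ω d + V * ω (2 * n)) ^ p) := by gcongr
        _ = _ := by ring
    refine (ENNReal.rpow_le_rpow htotal (by positivity)).trans ?_
    have hs0 : 0 ≤ U * ω d + V * ω (2 * n) := by positivity
    rw [ENNReal.ofReal_rpow_of_nonneg (by positivity) (by positivity),
      Real.mul_rpow (by positivity) (by positivity), ← Real.rpow_mul hs0,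
      mul_one_div_cancel hp.ne', Real.rpow_one, mul_assoc]
    refine ENNReal.ofReal_le_ofReal (mul_le_mul_of_nonneg_left ?_ (by positivity))
    have h7 := mul_le_mul_of_nonneg_left (hdbl n hn) hV
    have h8 := mul_nonneg hU hωd
    nlinarith

theorem IsDoublingWeight.exists_le_errorQNorm (hω : IsDoublingWeight ω) {q : ℝ≥0∞} (hq : 0 < q) :
    ∃ c : ℝ, 0 < c ∧ ∀ (N : X → ℝ) (E : ℕ → X → ℝ≥0∞) (x : X) (H : ℝ) (n : ℕ), 0 ≤ H → 1 ≤ n →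
      (∀ k < n, ENNReal.ofReal H ≤ E (k + 1) x) →
      ENNReal.ofReal (c * H * ω n) ≤ errorQNorm N ω q E x := by
  by_cases hq' : q = ∞
  · refine ⟨1, one_pos, fun N E x H n hH hn h => ?_⟩
    rw [errorQNorm, if_pos hq', one_mul]
    refine le_add_left (le_iSup_of_le (n - 1) ?_)
    rw [mul_comm, ENNReal.ofReal_mul (hω.pos_of_one_le hn).le]
    have h1 := h (n - 1) (by omega)
    rw [Nat.sub_add_cancel hn] at h1 ⊢
    gcongr
  · have hp : 0 < q.toReal := ENNReal.toReal_pos hq.ne' hq'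
    set p := q.toReal with hpdef
    obtain ⟨c, hc, hsum⟩ := hω.exists_le_sum_rpow hp
    refine ⟨c ^ (1 / p), by positivity, fun N E x H n hH hn h => ?_⟩
    rw [errorQNorm, if_neg hq', ← hpdef]
    refine le_add_left ?_
    have hωn := (hω.pos_of_one_le hn).le
    have hw : ∀ k : ℕ, 0 ≤ ω (k + 1) ^ p / (k + 1 : ℕ) := fun k =>
      div_nonneg (Real.rpow_nonneg (hω.pos_of_one_le k.succ_pos).le p) (Nat.cast_nonneg _)
    have hHp := Real.rpow_nonneg hH p
    have h1 : ENNReal.ofReal (H ^ p * (c * ω n ^ p)) ≤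
        ∑' k : ℕ, (ENNReal.ofReal (ω (k + 1)) * E (k + 1) x) ^ p / ((k + 1 : ℕ) : ℝ≥0∞) := by
      refine le_trans ?_ (ENNReal.sum_le_tsum (Finset.range n))
      refine (ENNReal.ofReal_le_ofReal (mul_le_mul_of_nonneg_left (hsum n hn) hHp)).trans ?_
      rw [Finset.mul_sum, ENNReal.ofReal_sum_of_nonneg fun k _ => mul_nonneg hHp (hw k)]
      refine Finset.sum_le_sum fun k hk => ?_
      rw [← ofReal_mul_rpow_div (hω.pos_of_one_le k.succ_pos).le hH hp.le]
      gcongr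
      exact h k (Finset.mem_range.1 hk)
    refine le_trans (le_of_eq ?_) (ENNReal.rpow_le_rpow h1 (by positivity : 0 ≤ 1 / p))
    have hs0 : 0 ≤ H * ω n := by positivity
    rw [ENNReal.ofReal_rpow_of_nonneg (by positivity) (by positivity),
      show H ^ p * (c * ω n ^ p) = c * (H * ω n) ^ p by rw [Real.mul_rpow hH hωn]; ring,
      Real.mul_rpow hc.le (by positivity), ← Real.rpow_mul hs0, mul_one_div_cancel hp.ne',
      Real.rpow_one, mul_assoc]

end Weights

/-! ### From the embedding to super-democracy -/

section Converse

variable {𝕜 : Type*} [RCLike 𝕜] {X : Type*} [AddCommGroup X] [Module 𝕜 X] {N : X → ℝ}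
  {e : ℕ → X} {es : ℕ → X →ₗ[𝕜] 𝕜} {ω : ℕ → ℝ}

theorem bestTermError_le_of_card_le (x : X) {m : ℕ} {S : Finset ℕ} (hS : S.card ≤ m)
    (b : ℕ → 𝕜) :
    bestTermError 𝕜 N e m x ≤ ENNReal.ofReal (N (x - ∑ n ∈ S, b n • e n)) := by
  obtain ⟨A, hSA, hA⟩ := Infinite.exists_superset_card_eq S m hS
  have h := bestTermError_le_of_sum (N := N) (e := e) x hA fun n => if n ∈ S then b n else 0
  have h1 : ∑ n ∈ A, (if n ∈ S then b n else 0) • e n = ∑ n ∈ S, b n • e n := by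
    rw [← Finset.sum_subset hSA fun n _ hn => by rw [if_neg hn, zero_smul]]
    exact Finset.sum_congr rfl fun n hn => by rw [if_pos hn]
  rwa [h1] at h

/-- Testing the embedding on `2 • 1_{εB} + 1_{δD}`, with `D` far to the right of `B`. -/
theorem exists_democracy_bound (hN : IsQuasiBanach 𝕜 N) (hB : IsMBasis N e es)
    (hω : IsDoublingWeight ω) (hi : 0 < lowerDilationIndex ω) (hS : IsSchauder N e es)
    (hW : HasPropertyW 𝕜 N e) {q : ℝ≥0∞} (hq : 0 < q)
    (hemb : ContEmbeds (approxQNorm 𝕜 N e ω q) (chebyshevQNorm N e es ω q)) :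
    ∃ R : ℝ, 0 < R ∧ ∀ (B : Finset ℕ) (ε : ℕ → 𝕜) (d : ℕ), (∀ k ∈ B, ‖ε k‖ = 1) → 1 ≤ d →
      d ≤ B.card → realDemocracy 𝕜 N e d * ω B.card ≤
        R * ((2 * N (indicatorSum e ε B) + realDemocracy 𝕜 N e d) * ω d +
          N (indicatorSum e ε B) * ω B.card) := by
  obtain ⟨κ, hκ, hadd, hsub⟩ := hN.exists_modulus
  have hκ0 : 0 < κ := by linarith
  obtain ⟨Cs, hCs, hS⟩ := hS
  obtain ⟨Cw, hCw, hW⟩ := hW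
  obtain ⟨-, Ce, hCe, hemb⟩ := hemb
  obtain ⟨C, hC, hupper⟩ := hω.exists_errorQNorm_le (X := X) hi hq
  obtain ⟨c, hc, hlower⟩ := hω.exists_le_errorQNorm (X := X) hq
  have hω1 := hω.pos
  set Q := Cw * (κ * (1 + Cs)) with hQ
  have hQ0 : 0 < Q := by positivity
  refine ⟨Q / c * (Ce * ((1 / ω 1 + C) * κ + 2 * C)), by positivity, fun B ε d hε hd hdn => ?_⟩
  set n := B.card with hn
  set V := N (indicatorSum e ε B) with hV
  set h := realDemocracy 𝕜 N e d with hh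
  have hV0 : 0 ≤ V := hN.nonneg _
  have hh0 : 0 ≤ h := realDemocracy_nonneg d
  have hωd := hω.pos_of_one_le hd
  have hωn := hω.pos_of_one_le (hd.trans hdn)
  -- Property (W) requires `m ≥ d`; the other entry puts `D` beyond all of `B`.
  set m := max d (B.sup id + 1) with hm
  obtain ⟨D, δ, hDm, hDd, hδ, hWD⟩ := hW d m hd (le_max_left _ _)
  have hBm : ∀ k ∈ B, k < m := fun k hk => by
    have : id k ≤ B.sup id := Finset.le_sup hk
    have h2 : B.sup id + 1 ≤ m := le_max_right _ _
    simp only [id] at this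
    omega
  have hDm' : ∀ k ∈ D, m ≤ k := fun k hk => by have := hDm k hk; omega
  have hDB : ∀ k ∈ B, k ∉ D := fun k hk hk' => by
    have := hBm k hk; have := hDm' k hk'; omega
  have hWD' : h ≤ Cw * N (indicatorSum e δ D) := by
    rw [← hB.ofReal_realDemocracy hN, ← ENNReal.ofReal_mul hCw.le,
      ENNReal.ofReal_le_ofReal_iff (mul_nonneg hCw.le (hN.nonneg _))] at hWD
    exact hWD
  set x : X := (2 : 𝕜) • indicatorSum e ε B + indicatorSum e δ D with hx
  have hcoeffD : ∀ k, es k (indicatorSum e δ D) = if k ∈ D then δ k else 0 :=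
    hB.coeff_sum D δ
  have hcoeff : ∀ k, es k x = 2 * (if k ∈ B then ε k else 0) + if k ∈ D then δ k else 0 :=
    fun k => by
      rw [hx, map_add, map_smul, hcoeffD, indicatorSum, hB.coeff_sum, smul_eq_mul]
  have hN2 : N ((2 : 𝕜) • indicatorSum e ε B) = 2 * V := by
    rw [hN.smul, RCLike.norm_ofNat]
  set U := κ * (2 * V + h) with hU
  have hU0 : 0 ≤ U := by positivity
  have hNx : N x ≤ U := by
    refine (hadd _ _).trans ?_
    rw [hN2]
    have := hB.indicatorSum_le hN hDd.le hδ
    rw [hU, hh]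
    gcongr
  have hup : approxQNorm 𝕜 N e ω q x ≤
      ENNReal.ofReal (N x + C * (U * ω d + 2 * V * ω n)) := by
    -- The approximants on the three ranges are `0`, `1_{δD}` and `x` itself.
    refine hupper N _ x U (2 * V) d n (hN.nonneg x) hU0 (by positivity) hd hdn
      (fun k _ => ?_) (fun k hk _ => ?_) (fun k hk => ?_)
    · have := bestTermError_le_of_card_le (𝕜 := 𝕜) (N := N) (e := e) x (m := k + 1) (S := ∅)
        (by simp) 0
      rw [Finset.sum_empty, sub_zero] at this
      exact this.trans (ENNReal.ofReal_le_ofReal hNx)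
    · refine (bestTermError_le_of_card_le (𝕜 := 𝕜) x (S := D) (by omega) δ).trans ?_
      rw [hx, indicatorSum, indicatorSum, add_sub_cancel_right, ← indicatorSum, hN2]
    · have hcard := Finset.card_union_le B D
      have := bestTermError_le_of_card_le (𝕜 := 𝕜) (N := N) (e := e) x (m := k + 1) (S := B ∪ D)
        (by omega) (fun k => es k x)
      have hx0 : x - ∑ k ∈ B ∪ D, es k x • e k = 0 := hB.total _ fun k => by
        rw [map_sub, hB.coeff_sum]
        split_ifs with hk
        · ring
        · rw [Finset.mem_union, not_or] at hk
          rw [hcoeff, if_neg hk.1, if_neg hk.2]; ring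
      rw [hx0, hN.map_zero, ENNReal.ofReal_zero] at this
      exact le_antisymm this bot_le
  have hlow : ENNReal.ofReal (c * (h / Q) * ω n) ≤ chebyshevQNorm N e es ω q x := by
    refine hlower N _ x (h / Q) n (by positivity) (hd.trans hdn) fun k hk => ?_
    obtain ⟨π, hπ⟩ := hB.exists_greedyOrdering hN x
    refine le_iSup₂_of_le π hπ (le_iInf fun a => ENNReal.ofReal_le_ofReal ?_)
    set y : X := x - ∑ i ∈ Finset.range (k + 1), a i • e (π i) with hy
    -- The factor `2` makes the coefficients on `B` strictly dominant, so every greedy ordering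
    -- starts with `B`.
    have himage : (Finset.range n).image π = B := hπ.image_range fun i hi j hj => by
      have h1 : ‖es i x‖ = 2 := by
        rw [hcoeff, if_pos hi, if_neg (hDB i hi), add_zero, norm_mul, hε i hi, RCLike.norm_ofNat,
          mul_one]
      have h2 : ‖es j x‖ ≤ 1 := by
        rw [hcoeff, if_neg hj, mul_zero, zero_add]
        split_ifs with hjD
        · exact (hδ j hjD).le
        · simp
      linarith
    have hπB : ∀ i ≤ k, π i < m := fun i hik => hBm _ (by
      rw [← himage]
      exact Finset.mem_image_of_mem _ (Finset.mem_range.2 (by omega)))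
    have hD : indicatorSum e δ D = y - basisPartialSum e es m y := by
      rw [← sub_eq_zero]
      refine hB.total _ fun j => ?_
      rw [map_sub, map_sub, basisPartialSum, hB.coeff_sum, hcoeffD]
      by_cases hj : j < m
      · rw [if_pos (Finset.mem_range.2 hj), if_neg fun hjD => absurd (hDm' j hjD) (not_le.2 hj)]
        ring
      · have h1 : es j (∑ i ∈ Finset.range (k + 1), a i • e (π i)) = 0 := by
          rw [map_sum]
          refine Finset.sum_eq_zero fun i hi => ?_
          have h2 := hπB i (Nat.lt_succ_iff.1 (Finset.mem_range.1 hi))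
          rw [map_smul, hB.biorthogonal, if_neg (by omega), smul_zero]
        rw [if_neg (fun h => hj (Finset.mem_range.1 h) : j ∉ Finset.range m), hy, map_sub, h1,
          hcoeff, if_neg fun hjB => hj (hBm j hjB)]
        ring
    have hm1 : 1 ≤ m := hd.trans (le_max_left _ _)
    rw [div_le_iff₀ hQ0]
    calc h ≤ Cw * N (indicatorSum e δ D) := hWD'
      _ ≤ Cw * (κ * (N y + Cs * N y)) := by
        rw [hD]
        refine mul_le_mul_of_nonneg_left ((hsub _ _).trans ?_) hCw.le
        gcongr
        exact hS m y hm1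
      _ = N y * Q := by rw [hQ]; ring
  have hfin : x ∈ finiteClass (approxQNorm 𝕜 N e ω q) := hup.trans_lt ENNReal.ofReal_lt_top
  have hmain := (hlow.trans (hemb x hfin)).trans (mul_le_mul_right hup _)
  have hNx0 := hN.nonneg x
  rw [← ENNReal.ofReal_mul hCe.le, ENNReal.ofReal_le_ofReal_iff (by positivity)] at hmain
  -- The summand `‖x‖` merges with the weighted terms because `ω(1) ≤ ω(d)`.
  have hU1 : N x ≤ 1 / ω 1 * (U * ω d) := by
    rw [one_div, le_inv_mul_iff₀ hω1, mul_comm]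
    exact mul_le_mul hNx (hω.mono 1 d le_rfl hd) hω1.le hU0
  have hVd : 0 ≤ (2 * V + h) * ω d := by positivity
  have hVn : 0 ≤ V * ω n := by positivity
  have h1 : N x + C * (U * ω d + 2 * V * ω n) ≤
      ((1 / ω 1 + C) * κ + 2 * C) * ((2 * V + h) * ω d + V * ω n) := by
    have h2 : 0 ≤ (1 / ω 1 + C) * κ * (V * ω n) := by positivity
    have h3 : 0 ≤ 2 * C * ((2 * V + h) * ω d) := by positivity
    rw [hU] at hU1 ⊢
    linarith
  calc h * ω n = Q / c * (c * (h / Q) * ω n) := by field_simp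
    _ ≤ Q / c * (Ce * (((1 / ω 1 + C) * κ + 2 * C) * ((2 * V + h) * ω d + V * ω n))) := by
      refine mul_le_mul_of_nonneg_left (hmain.trans ?_) (by positivity)
      exact mul_le_mul_of_nonneg_left h1 hCe.le
    _ = _ := by ring

theorem isSuperDemocratic_of_contEmbeds (hN : IsQuasiBanach 𝕜 N) (hB : IsMBasis N e es)
    (hω : IsDoublingWeight ω) (hi : 0 < lowerDilationIndex ω) (hS : IsSchauder N e es)
    (hW : HasPropertyW 𝕜 N e) {q : ℝ≥0∞} (hq : 0 < q)
    (hemb : ContEmbeds (approxQNorm 𝕜 N e ω q) (chebyshevQNorm N e es ω q)) :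
    IsSuperDemocratic 𝕜 N e := by
  obtain ⟨R, hR, hbound⟩ := exists_democracy_bound hN hB hω hi hS hW hq hemb
  obtain ⟨c, hc, -, hes⟩ := hB.exists_bound hN
  -- With `ω(n) ≥ 2R ω(d)` the term `R h_r(d) ω(d)` is at most half the left side of the bound.
  obtain ⟨M, hM, hdil⟩ := hω.exists_dilation_ge hi (2 * R)
  obtain ⟨C, hC, hmul⟩ := hB.exists_realDemocracy_mul_le hN (2 * M)
  have hhM := realDemocracy_nonneg (𝕜 := 𝕜) (N := N) (e := e) M
  refine ⟨C * (6 * R) + realDemocracy 𝕜 N e M * c + 1, by positivity, fun B ε hε => ?_⟩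
  set V := N (indicatorSum e ε B) with hV
  have hV0 : 0 ≤ V := hN.nonneg _
  have h1 : 0 ≤ C * (6 * R) * V := by positivity
  have h2 : 0 ≤ realDemocracy 𝕜 N e M * c * V := by positivity
  rcases B.eq_empty_or_nonempty with rfl | ⟨k, hk⟩
  · rw [Finset.card_empty, realDemocracy_zero hN]
    positivity
  rcases lt_or_ge B.card M with hlt | hge
  -- For fewer than `M` indices, a single coefficient already bounds `‖1_{εB}‖` below.
  · have hcV : 1 ≤ c * V := by
      have := hes k (indicatorSum e ε B)
      rwa [indicatorSum, hB.coeff_sum, if_pos hk, hε k hk] at this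
    have h3 := hB.realDemocracy_mono hN (𝕜 := 𝕜) hlt.le
    have h4 := mul_le_mul_of_nonneg_left hcV hhM
    linarith
  · set d := B.card / M with hd
    have hd1 : 1 ≤ d := Nat.div_pos hge hM
    have hdn : d ≤ B.card := Nat.div_le_self _ _
    have hMd : M * d ≤ B.card := Nat.mul_div_le _ _
    have hn2 : B.card ≤ 2 * M * d := by
      have h3 : B.card < M * (d + 1) := Nat.lt_mul_div_succ _ hM
      nlinarith
    have hωn := hω.pos_of_one_le (hd1.trans hdn)
    have hωd : 2 * R * ω d ≤ ω B.card :=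
      (hdil d hd1).trans (hω.mono _ _ (Nat.mul_pos hM hd1) hMd)
    have hωd' := hω.mono d _ hd1 hdn
    have h3 := hbound B ε d hε hd1 hdn
    rw [← hV] at h3
    set h := realDemocracy 𝕜 N e d with hh
    have hh0 : 0 ≤ h := realDemocracy_nonneg d
    -- After absorption, `h/2 ≤ 2RV + RV`.
    have h4 : h ≤ 6 * R * V := by
      refine le_of_mul_le_mul_right ?_ hωn
      have h5 := mul_le_mul_of_nonneg_left hωd hh0
      have h6 := mul_le_mul_of_nonneg_left hωd' (mul_nonneg hR.le hV0)
      nlinarith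
    have h5 : realDemocracy 𝕜 N e B.card ≤ C * h :=
      (hB.realDemocracy_mono hN hn2).trans (hmul d)
    have h6 := mul_le_mul_of_nonneg_left h4 hC
    linarith

end Converse

theorem theorem1p3 {𝕜 : Type*} [RCLike 𝕜] {X : Type*} [AddCommGroup X] [Module 𝕜 X]
    (N : X → ℝ) (hN : IsQuasiBanach 𝕜 N)
    (e : ℕ → X) (es : ℕ → X →ₗ[𝕜] 𝕜) (hB : IsMBasis N e es) (hqg : IsQuasiGreedy N e es)
    (ω : ℕ → ℝ) (hω : IsDoublingWeight ω) (hi : 0 < lowerDilationIndex ω) :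
    (IsSemiGreedy N e es → ∀ q : ℝ≥0∞, 0 < q →
      ClassesEquiv (approxQNorm 𝕜 N e ω q) (chebyshevQNorm N e es ω q)) ∧
    (IsSchauder N e es → HasPropertyW 𝕜 N e →
      (∃ q : ℝ≥0∞, 0 < q ∧
        ClassesEquiv (approxQNorm 𝕜 N e ω q) (chebyshevQNorm N e es ω q)) →
      IsSemiGreedy N e es) := by
  refine ⟨fun ⟨C, _, hsg⟩ q hq => ⟨?_, ?_⟩, fun hS hW ⟨q, hq, hemb, _⟩ => ?_⟩
  · refine ContEmbeds.of_le (C := max C 1) (by positivity) fun x => ?_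
    refine errorQNorm_mono hq ?_ x fun n => (hsg (n + 1) x n.succ_pos).trans ?_
    · exact ENNReal.one_le_ofReal.2 (le_max_right C 1)
    · gcongr
      exact le_max_left C 1
  · refine ContEmbeds.of_le one_pos fun x => ?_
    refine errorQNorm_mono hq (by simp) x fun n => ?_
    simpa using hB.bestTermError_le_chebyshevGreedyError hN (n + 1) x
  · exact (isSuperDemocratic_of_contEmbeds hN hB hω hi hS hW hq hemb).isSemiGreedy hN hB hqg
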